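/- For an integer $n\ge 1$ and a graph $H$, the anti-Ramsey number $AR(n,H)$ is the maximum number of colors used in an edge-coloring of the complete graph $K_n$ (an arbitrary assignment of colors to the edges) that contains no rainbow copy of $H$, that is, no subgraph isomorphic to $H$ whose edges have pairwise distinct colors. Let $P_\ell$ denote the path on $\ell$ vertices and $mG$ the vertex-disjoint union of $m$ copies of $G$. Theorem. For all integers $k\ge 2$ and $n=4k$, $$AR(n,kP_4)=(2k-1)(4k-3)+1,$$ and moreover $AR(n,kP_4)>AR(n,2kP_2)$. -/

import Mathlib

namespace AntiRamsey

/-- The graph `kG`: the vertex-disjoint union of `k` copies of `G`. -/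
def copies {V : Type*} (k : ℕ) (G : SimpleGraph V) : SimpleGraph (Fin k × V) where
  Adj x y := x.1 = y.1 ∧ G.Adj x.2 y.2
  symm := ⟨fun _ _ h => ⟨h.1.symm, h.2.symm⟩⟩
  loopless := ⟨fun _ h => h.2.ne rfl⟩

/-- The edge-colouring `c` of `G` contains a rainbow copy of `H`: there is a (not necessarily
induced) copy of `H` in `G` whose edges receive pairwise distinct colours. -/
def HasRainbowCopy {V W C : Type*} {G : SimpleGraph V} (c : G.edgeSet → C)
    (H : SimpleGraph W) : Prop :=
  ∃ f : SimpleGraph.Copy H G, Function.Injective fun e : H.edgeSet => c (f.mapEdgeSet e)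

/-- The set of all numbers of colours actually used by an edge-colouring of the complete graph
`K_n` that contains no rainbow copy of `H`. -/
def rainbowFreeCounts {W : Type*} (n : ℕ) (H : SimpleGraph W) : Set ℕ :=
  {m | ∃ c : (⊤ : SimpleGraph (Fin n)).edgeSet → ℕ,
    ¬ HasRainbowCopy c H ∧ (Set.range c).ncard = m}

/-- The anti-Ramsey number `AR(n, H)`: the maximum number of colours in an edge-colouring of
`K_n` without a rainbow copy of `H`. -/
noncomputable def antiRamsey {W : Type*} (n : ℕ) (H : SimpleGraph W) : ℕ :=
  sSup (rainbowFreeCounts n H)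

/-- The supremum is over a bounded set. -/
theorem bddAbove_rainbowFreeCounts {W : Type*} (n : ℕ) (H : SimpleGraph W) :
    BddAbove (rainbowFreeCounts n H) := by
  classical
  refine ⟨Nat.card (⊤ : SimpleGraph (Fin n)).edgeSet, ?_⟩
  rintro m ⟨c, -, rfl⟩
  rw [← Set.image_univ, ← Set.ncard_univ]
  exact Set.ncard_image_le Set.finite_univ

/-- The supremum is a maximum as soon as some colouring of `K_n` has no rainbow copy of `H`. -/
theorem isGreatest_antiRamsey {W : Type*} {n : ℕ} {H : SimpleGraph W}
    (h : (rainbowFreeCounts n H).Nonempty) :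
    IsGreatest (rainbowFreeCounts n H) (antiRamsey n H) :=
  ⟨Nat.sSup_mem h (bddAbove_rainbowFreeCounts n H),
    fun _ hm => le_csSup (bddAbove_rainbowFreeCounts n H) hm⟩

end AntiRamsey

/-! Write n = 4k. The lower bound comes from giving one colour to all edges meeting a fixed pair {u,
v} and a private colour to every other edge. A copy of kP_4 is spanning, and any two vertices of it
lie on two different edges, so the common colour repeats. With 2kP_2 this fails, since uv itself may
be a matching edge; this is what separates the two numbers.

For the upper bounds, take a transversal G, with one edge of each colour; every subgraph of G is
rainbow. A Hamiltonian path in G yields both kP_4 and 2kP_2. If there is none, Chvátal's condition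
(`exists_degree_le_of_not_traceable`) gives an index h with h + 1 vertices of degree at most h and n
- h vertices of degree at most n - h - 2. With more than C(n-2, 2) edges, counting forces h ≤ 1
unless n = 8 (`chvatal_index_le_one_or`): there is an isolated vertex, or there are two vertices of
degree at most 1.

These obstructions are removed by exchange (`IsTransversal.exists_swap`): any chosen edge can enter
the transversal at the cost of the edge of its colour. With C(n-2, 2) + 2 colours this produces a
Hamiltonian path. With one colour fewer it still produces a perfect matching: the edge between two
low vertices is exchanged in, and what remains after deleting its ends is nearly complete.

For n = 8 the indices h = 2 and h = 3 survive the count. They are settled on labelled vertices by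
linear arithmetic on adjacency indicators, again after at most one exchange. -/

namespace AntiRamsey

/-! ### Hamiltonian paths: Ore's rotation and Chvátal's degree condition -/

/-- `G` has a Hamiltonian path, given as the list of its vertices. -/
def Traceable {V : Type*} (G : SimpleGraph V) : Prop :=
  ∃ l : List V, l.Nodup ∧ (∀ v, v ∈ l) ∧ l.IsChain G.Adj

theorem traceable_top {V : Type*} [Finite V] : Traceable (⊤ : SimpleGraph V) := by
  classical
  have := Fintype.ofFinite V
  refine ⟨Finset.univ.toList, Finset.nodup_toList _, by simp, ?_⟩
  exact (List.Pairwise.isChain (Finset.nodup_toList _)).imp fun a b h => h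

/-- A counting lemma: if no two consecutive entries satisfy `P` and `Q` in this order, then the
two predicates together hold at most once per consecutive pair. -/
theorem countP_dropLast_add_countP_tail_le {α : Type*} (P Q : α → Bool) (a : α) (l : List α)
    (h : ∀ s x y t, a :: l = s ++ x :: y :: t → ¬ (P x ∧ Q y)) :
    (a :: l).dropLast.countP P + l.countP Q ≤ l.length := by
  induction l generalizing a with
  | nil => simp
  | cons b l ih =>
    have h1 := ih b fun s x y t e => h (a :: s) x y t (by simp [e])
    have h2 := h [] a b l rfl
    rw [List.dropLast_cons_cons, List.countP_cons, List.countP_cons, List.length_cons]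
    by_cases hP : P a <;> by_cases hQ : Q b <;> simp_all <;> omega

/-- Shifting `Q` by one position loses nothing, as the head fails `Q` and the last entry fails `P`;
then each of the `l.length - 1` consecutive pairs counts at most once. -/
theorem countP_add_countP_lt {α : Type*} (P Q : α → Bool) (l : List α) (hl : l ≠ [])
    (h : ∀ s x y t, l = s ++ x :: y :: t → ¬ (P x ∧ Q y))
    (hP : ∀ x ∈ l.getLast?, ¬ P x) (hQ : ∀ x ∈ l.head?, ¬ Q x) :
    l.countP P + l.countP Q < l.length := by
  have hP' : ¬ P (l.getLast hl) := hP _ (List.getLast?_eq_some_getLast hl)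
  have h0 : l.countP P = l.dropLast.countP P := by
    conv_lhs => rw [← List.dropLast_append_getLast hl]
    simp [List.countP_append, hP']
  obtain _ | ⟨a, l⟩ := l
  · exact absurd rfl hl
  · have h1 := countP_dropLast_add_countP_tail_le P Q a l h
    rw [h0, List.countP_cons]
    simp at hQ
    simp [hQ]
    omega

/-- A path that misses one end of the added edge cannot use that edge. -/
theorem isChain_of_isChain_sup_edge {V : Type*} {G : SimpleGraph V} {u v x : V} {l : List V}
    (hx : x = u ∨ x = v) (hxl : x ∉ l) (hl : l.IsChain (G ⊔ SimpleGraph.edge u v).Adj) :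
    l.IsChain G.Adj := by
  refine hl.imp_of_mem_imp fun a b ha hb hab => ?_
  rcases hab with hab | hab
  · exact hab
  · rw [SimpleGraph.edge_adj] at hab
    grind

/-- If adding the edge `uv` makes a graph traceable which was not so before, then the new
Hamiltonian path splits at this edge into two paths. -/
theorem exists_split_of_traceable_sup_edge {V : Type*} {G : SimpleGraph V} {u v : V}
    (hG : ¬ Traceable G) (h : Traceable (G ⊔ SimpleGraph.edge u v)) :
    ∃ x y l₁ l₂, (x = u ∧ y = v ∨ x = v ∧ y = u) ∧ (l₁ ++ [x] ++ y :: l₂).Nodup ∧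
      (∀ w, w ∈ l₁ ++ [x] ++ y :: l₂) ∧ (l₁ ++ [x]).IsChain G.Adj ∧ (y :: l₂).IsChain G.Adj := by
  obtain ⟨l, hn, hm, hc⟩ := h
  have h1 : ¬ l.IsChain G.Adj := fun h => hG ⟨l, hn, hm, h⟩
  rw [List.isChain_iff_forall_rel_of_append_cons_cons] at h1
  push Not at h1
  obtain ⟨x, y, l₁, l₂, rfl, hxy⟩ := h1
  rw [List.isChain_append_cons_cons] at hc
  obtain ⟨hc1, hc2, hc3⟩ := hc
  have hxy' : x = u ∧ y = v ∨ x = v ∧ y = u := by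
    rcases hc2 with h | h
    · exact absurd h hxy
    · exact ((SimpleGraph.edge_adj ..).1 h).1
  refine ⟨x, y, l₁, l₂, hxy', by simpa using hn, by simpa using hm,
    isChain_of_isChain_sup_edge (x := y) (by tauto) ?_ hc1,
    isChain_of_isChain_sup_edge (x := x) (by tauto) ?_ hc3⟩
  · simp [List.nodup_append] at hn ⊢
    grind
  · simp [List.nodup_append] at hn ⊢
    grind

/-- Ore's rotation argument: two vertices whose joining would make a non-traceable graph traceable
have small degree sum. -/
theorem degree_add_degree_lt_of_traceable_sup_edge {V : Type*} [Fintype V] {G : SimpleGraph V}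
    [DecidableRel G.Adj] {u v : V} (hG : ¬ Traceable G) (huv : ¬ G.Adj u v)
    (h : Traceable (G ⊔ SimpleGraph.edge u v)) :
    G.degree u + G.degree v + 2 ≤ Fintype.card V := by
  classical
  obtain ⟨x, y, l₁, l₂, hxy, hn, hm, hc₁, hc₂⟩ := exists_split_of_traceable_sup_edge hG h
  have hadj : ¬ G.Adj x y := by
    rcases hxy with ⟨rfl, rfl⟩ | ⟨rfl, rfl⟩
    · exact huv
    · exact fun h => huv h.symm
  have key : ∀ l : List V, l.Perm (l₁ ++ [x] ++ y :: l₂) → ¬ l.IsChain G.Adj := fun l hl hc =>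
    hG ⟨l, hl.nodup_iff.2 hn, fun w => hl.mem_iff.2 (hm w), hc⟩
  have hrev : ∀ l : List V, l.IsChain G.Adj → l.reverse.IsChain G.Adj := fun l hl =>
    List.isChain_reverse.2 (hl.imp fun a b h => h.symm)
  have hdeg : ∀ z, G.degree z =
      (l₁ ++ [x]).countP (G.Adj z ·) + (y :: l₂).countP (G.Adj z ·) := by
    intro z
    rw [← List.countP_append, List.countP_eq_length_filter, ← List.toFinset_card_of_nodup (hn.filter _),
      ← SimpleGraph.card_neighborFinset_eq_degree]
    congr 1
    ext w
    have := hm w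
    simp at this ⊢
    tauto
  have hlen : Fintype.card V = (l₁ ++ [x] ++ y :: l₂).length := by
    rw [← List.toFinset_card_of_nodup hn, ← Finset.card_univ]
    congr 1
    ext w
    have := hm w
    simp at this ⊢
    tauto
  have hsum : G.degree u + G.degree v = G.degree x + G.degree y := by
    rcases hxy with ⟨rfl, rfl⟩ | ⟨rfl, rfl⟩
    · rfl
    · exact add_comm _ _
  have h1 : (l₁ ++ [x]).countP (G.Adj x ·) + (l₁ ++ [x]).countP (G.Adj y ·) <
      (l₁ ++ [x]).length := by
    refine countP_add_countP_lt _ _ _ (by simp) ?_ (by simp) ?_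
    · rintro s a b t hs ⟨ha, hb⟩
      rw [hs] at hc₁
      rw [List.isChain_append_cons_cons] at hc₁
      have hlast : x ∈ (b :: t).getLast? := by
        have := congrArg List.getLast? hs
        simpa using this.symm
      -- Rotation: follow the first path to `a`, jump to its end `x`, run back to `b`, and jump to
      -- `y`.
      refine key (s ++ [a] ++ (b :: t).reverse ++ y :: l₂) ?_ ?_
      · rw [hs]
        simp only [List.append_assoc]
        refine List.Perm.append_left _ ?_
        exact (((List.reverse_perm (b :: t)).append_right (y :: l₂)).cons a)
      · refine (hc₁.1.append (hrev _ hc₁.2.2) ?_).append hc₂ ?_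
        · intro p hp q hq
          rw [List.head?_reverse, hlast] at hq
          simp at hp hq
          subst hp hq
          simpa using (of_decide_eq_true ha).symm
        · intro p hp q hq
          rw [List.getLast?_append, List.getLast?_reverse] at hp
          simp at hp hq
          subst hp hq
          exact (of_decide_eq_true hb).symm
    · intro p hp hyp
      refine key ((l₁ ++ [x]).reverse ++ y :: l₂) (List.Perm.append_right _ (List.reverse_perm _)) ?_
      refine (hrev _ hc₁).append hc₂ ?_
      intro p' hp' q hq
      rw [List.getLast?_reverse, hp] at hp'
      simp at hp' hq
      subst hp' hq
      exact (of_decide_eq_true hyp).symm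
  have h2 : (y :: l₂).countP (G.Adj x ·) + (y :: l₂).countP (G.Adj y ·) <
      (y :: l₂).length := by
    refine countP_add_countP_lt _ _ _ (by simp) ?_ ?_ (by simp)
    · rintro s a b t hs ⟨ha, hb⟩
      rw [hs] at hc₂
      rw [List.isChain_append_cons_cons] at hc₂
      have hhead : y ∈ (s ++ [a]).head? := by
        have := congrArg List.head? hs
        cases s <;> simpa using this.symm
      -- The mirror image: jump from `x` to `a`, run back to `y`, and jump to `b`.
      refine key (l₁ ++ [x] ++ (s ++ [a]).reverse ++ b :: t) ?_ ?_
      · rw [hs, List.append_assoc (l₁ ++ [x])]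
        refine List.Perm.append_left _ ?_
        rw [show s ++ a :: b :: t = (s ++ [a]) ++ b :: t by simp]
        exact List.Perm.append_right _ (List.reverse_perm _)
      · refine (hc₁.append (hrev _ hc₂.1) ?_).append hc₂.2.2 ?_
        · intro p hp q hq
          simp at hp hq
          subst hp hq
          exact of_decide_eq_true ha
        · intro p hp q hq
          rw [List.getLast?_append, List.getLast?_reverse, hhead] at hp
          simp at hp hq
          subst hp hq
          exact of_decide_eq_true hb
    · intro p hp hxp
      refine key (l₁ ++ [x] ++ (y :: l₂).reverse) (List.Perm.append_left _ (List.reverse_perm _)) ?_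
      refine hc₁.append (hrev _ hc₂) ?_
      intro p' hp' q hq
      rw [List.head?_reverse, hp] at hq
      simp at hp' hq
      subst hp' hq
      exact of_decide_eq_true hxp
  rw [hsum, hdeg x, hdeg y, hlen, List.length_append]
  omega

theorem Traceable.mono {V : Type*} {G H : SimpleGraph V} (h : G ≤ H) (hG : Traceable G) :
    Traceable H := by
  obtain ⟨l, hn, hm, hc⟩ := hG
  exact ⟨l, hn, hm, hc.imp fun a b hab => h hab⟩

/-- Chvátal's degree condition for a Hamiltonian path. -/
theorem exists_degree_le_of_not_traceable {V : Type*} [Fintype V] {G : SimpleGraph V}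
    [DecidableRel G.Adj] (hG : ¬ Traceable G) :
    ∃ (h : ℕ) (X Y : Finset V), 2 * h + 2 ≤ Fintype.card V ∧ X ⊆ Y ∧ X.card = h + 1 ∧
      Y.card + h = Fintype.card V ∧ (∀ x ∈ X, G.degree x ≤ h) ∧
      ∀ y ∈ Y, G.degree y + h + 2 ≤ Fintype.card V := by
  classical
  -- Passing to an edge-maximal non-traceable graph makes Ore's inequality available for every
  -- non-adjacent pair; degree bounds descend to `G`.
  obtain ⟨M, hGM, hM⟩ := Finite.exists_le_maximal (p := fun H => ¬ Traceable H) hG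
  have hdeg : ∀ v, G.degree v ≤ M.degree v := fun v => SimpleGraph.degree_le_of_le hGM
  have hore : ∀ u v, u ≠ v → ¬ M.Adj u v → M.degree u + M.degree v + 2 ≤ Fintype.card V := by
    intro u v huv hadj
    refine degree_add_degree_lt_of_traceable_sup_edge hM.prop hadj ?_
    by_contra hnt
    exact hadj (hM.le_of_ge hnt le_sup_left (Or.inr ((SimpleGraph.edge_adj ..).2 ⟨by simp, huv⟩)))
  let S : Finset (V × V) := Finset.univ.filter fun p => p.1 ≠ p.2 ∧ ¬ M.Adj p.1 p.2
  have hS : S.Nonempty := by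
    by_contra hS
    rw [Finset.not_nonempty_iff_eq_empty] at hS
    refine hM.prop ((traceable_top (V := V)).mono fun a b hab => ?_)
    by_contra hadj
    have : (a, b) ∈ S := by simpa [S] using ⟨hab, hadj⟩
    simp [hS] at this
  -- The index `h` is the smaller degree in a non-adjacent pair of maximal degree sum.
  obtain ⟨⟨u, v⟩, huvS, hmax⟩ := S.exists_max_image (fun p => M.degree p.1 + M.degree p.2) hS
  wlog hle : M.degree u ≤ M.degree v generalizing u v
  · exact this v u (by simp [S, SimpleGraph.adj_comm, eq_comm] at huvS ⊢; tauto)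
      (fun p hp => by simpa [add_comm (M.degree v)] using hmax p hp) (by omega)
  have huv : u ≠ v ∧ ¬ M.Adj u v := by simpa [S] using huvS
  have hsum := hore u v huv.1 huv.2
  have hcard : ∀ z : V, (Finset.univ.filter fun w => ¬ M.Adj z w).card + M.degree z =
      Fintype.card V := by
    intro z
    rw [← SimpleGraph.card_neighborFinset_eq_degree, ← Finset.card_univ,
      ← Finset.card_filter_add_card_filter_not (s := Finset.univ) (fun w => M.Adj z w), add_comm]
    congr 2
    ext w
    simp
  set h := M.degree u
  -- The non-neighbours of `v` other than `v` number at least `h + 1` by `hsum`, and none exceeds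
  -- the degree of `u`, by maximality of the pair.
  have hX : h + 1 ≤ (Finset.univ.filter fun w => G.degree w ≤ h).card := by
    have h1 : ((Finset.univ.filter fun w => ¬ M.Adj v w).erase v) ⊆
        Finset.univ.filter fun w => G.degree w ≤ h := by
      intro w hw
      simp at hw ⊢
      have := hmax (w, v) (by simpa [S] using ⟨hw.1, fun h => hw.2 h.symm⟩)
      have := hdeg w
      simp at *
      omega
    have h2 := Finset.card_le_card h1
    rw [Finset.card_erase_of_mem (by simp)] at h2
    have := hcard v
    omega
  have hXY : (Finset.univ.filter fun w => G.degree w ≤ h) ⊆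
      Finset.univ.filter fun w => G.degree w + h + 2 ≤ Fintype.card V := by
    intro w hw
    simp at hw ⊢
    omega
  -- The `card V - h` non-neighbours of `u`, with `u` included, are bounded by Ore's inequality
  -- against `u`.
  have hY : Fintype.card V - h ≤
      (Finset.univ.filter fun w => G.degree w + h + 2 ≤ Fintype.card V).card := by
    have h1 : (Finset.univ.filter fun w => ¬ M.Adj u w) ⊆
        Finset.univ.filter fun w => G.degree w + h + 2 ≤ Fintype.card V := by
      intro w hw
      simp at hw ⊢
      have := hdeg w
      by_cases huw : u = w
      · subst huw
        omega
      · have := hore u w huw hw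
        omega
    have h2 := Finset.card_le_card h1
    have := hcard u
    omega
  obtain ⟨X, hXs, hXc⟩ := Finset.exists_subset_card_eq hX
  obtain ⟨Y, hXY', hYs, hYc⟩ := Finset.exists_subsuperset_card_eq (hXs.trans hXY)
    (by omega : X.card ≤ Fintype.card V - h) hY
  refine ⟨h, X, Y, by omega, hXY', hXc, by omega, fun x hx => by simpa using hXs hx,
    fun y hy => by simpa using hYs hy⟩

end AntiRamsey

/-! ### Transversals of a colouring and the exchange of edges -/

namespace AntiRamsey

/-- A graph containing exactly one edge of each colour. -/
def IsTransversal {V : Type*} (d : Sym2 V → ℕ) (G : SimpleGraph V) : Prop :=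
  Set.BijOn d G.edgeSet (d '' (⊤ : SimpleGraph V).edgeSet)

theorem exists_isTransversal {V : Type*} (d : Sym2 V → ℕ) :
    ∃ G : SimpleGraph V, IsTransversal d G := by
  obtain ⟨s, hs, hd⟩ := Set.exists_subset_bijOn (⊤ : SimpleGraph V).edgeSet d
  refine ⟨SimpleGraph.fromEdgeSet s, ?_⟩
  rw [IsTransversal, SimpleGraph.edgeSet_fromEdgeSet, sdiff_eq_left.2]
  · exact hd
  · rw [Set.disjoint_left]
    intro e he
    have := hs he
    simpa using this

theorem IsTransversal.card_edgeFinset {V : Type*} {d : Sym2 V → ℕ} {G : SimpleGraph V}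
    [Fintype G.edgeSet] (h : IsTransversal d G) :
    G.edgeFinset.card = (d '' (⊤ : SimpleGraph V).edgeSet).ncard := by
  rw [← h.image_eq, h.injOn.ncard_image, ← SimpleGraph.coe_edgeFinset,
    Set.ncard_coe_finset]

/-- Any edge can be brought into a transversal in exchange for the edge of the same colour. -/
theorem IsTransversal.exists_swap {V : Type*} {d : Sym2 V → ℕ} {G : SimpleGraph V}
    (h : IsTransversal d G) {p q : V} (hpq : p ≠ q) :
    ∃ (e : Sym2 V) (G' : SimpleGraph V), IsTransversal d G' ∧
      ∀ a b, G'.Adj a b ↔ s(a, b) = s(p, q) ∨ G.Adj a b ∧ s(a, b) ≠ e := by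
  obtain ⟨e, he, hde⟩ := h.surjOn ⟨s(p, q), by simpa using hpq, rfl⟩
  -- If `e` is `s(p, q)` itself, the removal is undone by the insertion and the graph is unchanged.
  let s : Set (Sym2 V) := insert s(p, q) (G.edgeSet \ {e})
  have hs : (SimpleGraph.fromEdgeSet s).edgeSet = s := by
    rw [SimpleGraph.edgeSet_fromEdgeSet, sdiff_eq_left]
    rw [Set.disjoint_left]
    rintro f (rfl | hf)
    · simpa using hpq
    · exact fun hf' => G.not_isDiag_of_mem_edgeSet hf.1 (by simpa using hf')
  refine ⟨e, SimpleGraph.fromEdgeSet s, ?_, ?_⟩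
  · rw [IsTransversal, hs]
    refine ⟨?_, ?_, ?_⟩
    · rintro f (rfl | hf)
      · exact ⟨_, by simpa using hpq, rfl⟩
      · exact h.mapsTo hf.1
    · rintro f (rfl | hf) g (rfl | hg) hfg
      · rfl
      · exact absurd (h.injOn hg.1 he (hfg.symm.trans hde.symm)) hg.2
      · exact absurd (h.injOn hf.1 he (hfg.trans hde.symm)) hf.2
      · exact h.injOn hf.1 hg.1 hfg
    · intro c hc
      obtain ⟨f, hf, rfl⟩ := h.surjOn hc
      by_cases hfe : f = e
      · exact ⟨s(p, q), Or.inl rfl, by rw [hfe, hde]⟩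
      · exact ⟨f, Or.inr ⟨hf, hfe⟩, rfl⟩
  · intro a b
    rw [← SimpleGraph.mem_edgeSet, hs]
    rfl

/-! ### Edge counts from degree bounds -/

section Counting

variable {V : Type*} [Fintype V] [DecidableEq V] (G : SimpleGraph V) [DecidableRel G.Adj]

theorem card_edgeFinset_le_induce_compl_add (S : Finset V) :
    G.edgeFinset.card ≤ (G.induce {v | v ∉ S}).edgeFinset.card +
      (S.biUnion fun v => G.incidenceFinset v).card := by
  rw [← Finset.card_map (Function.Embedding.subtype (fun v => v ∉ S)).sym2Map]
  refine (Finset.card_le_card ?_).trans (Finset.card_union_le _ _)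
  intro e he
  induction e with | _ a b
  rw [SimpleGraph.mem_edgeFinset, SimpleGraph.mem_edgeSet] at he
  rw [Finset.mem_union]
  by_cases ha : a ∈ S
  · exact Or.inr (Finset.mem_biUnion.2 ⟨a, ha, by simpa using he⟩)
  by_cases hb : b ∈ S
  · exact Or.inr (Finset.mem_biUnion.2 ⟨b, hb, by
      rw [Sym2.eq_swap]; simpa using he.symm⟩)
  · refine Or.inl (Finset.mem_map.2 ⟨s(⟨a, ha⟩, ⟨b, hb⟩), ?_, rfl⟩)
    simpa using he

theorem card_edgeFinset_induce_compl_le (S : Finset V) :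
    (G.induce {v | v ∉ S}).edgeFinset.card ≤ (Fintype.card V - S.card).choose 2 := by
  refine (SimpleGraph.card_edgeFinset_le_card_choose_two).trans_eq ?_
  congr 1
  have : Fintype.card {v // v ∉ S} = Fintype.card V - S.card := by simp
  exact this

theorem card_edgeFinset_le_choose_add_sum_degree (S : Finset V) :
    G.edgeFinset.card ≤ (Fintype.card V - S.card).choose 2 + ∑ v ∈ S, G.degree v := by
  refine (card_edgeFinset_le_induce_compl_add G S).trans ?_
  refine add_le_add (card_edgeFinset_induce_compl_le G S) (Finset.card_biUnion_le.trans_eq ?_)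
  simp

variable {G}

/-- The edge `xy` is counted at both ends, which makes the inequality strict. This saving of one
edge is needed later. -/
theorem card_edgeFinset_lt_induce_compl_pair_add {x y : V} (h : G.Adj x y) :
    G.edgeFinset.card < (G.induce {v | v ∉ ({x, y} : Finset V)}).edgeFinset.card +
      (G.degree x + G.degree y) := by
  refine (card_edgeFinset_le_induce_compl_add G {x, y}).trans_lt ?_
  refine add_lt_add_right ?_ _
  rw [Finset.biUnion_insert, Finset.singleton_biUnion]
  have h1 := Finset.card_union_add_card_inter (G.incidenceFinset x) (G.incidenceFinset y)
  have h2 : 0 < (G.incidenceFinset x ∩ G.incidenceFinset y).card :=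
    Finset.card_pos.2 ⟨s(x, y), by
      rw [Finset.mem_inter]
      exact ⟨by simpa using h, by rw [Sym2.eq_swap]; simpa using h.symm⟩⟩
  simp only [SimpleGraph.card_incidenceFinset_eq_degree] at h1
  omega

theorem card_edgeFinset_lt_choose_add_of_adj {x y : V} (h : G.Adj x y) :
    G.edgeFinset.card < (Fintype.card V - 2).choose 2 + (G.degree x + G.degree y) := by
  refine (card_edgeFinset_lt_induce_compl_pair_add h).trans_le ?_
  have := card_edgeFinset_induce_compl_le G {x, y}
  rw [Finset.card_pair h.ne] at this
  omega

/-- The number of edges of a graph with few high degrees, in the form in which Chvátal's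
condition provides it. -/
theorem two_mul_card_edgeFinset_le {h : ℕ} {X Y : Finset V} (hh : 2 * h + 2 ≤ Fintype.card V)
    (hXY : X ⊆ Y) (hX : X.card = h + 1) (hY : Y.card + h = Fintype.card V)
    (hdX : ∀ x ∈ X, G.degree x ≤ h) (hdY : ∀ y ∈ Y, G.degree y + h + 2 ≤ Fintype.card V) :
    2 * G.edgeFinset.card ≤ (h + 1) * h +
      (Fintype.card V - 2 * h - 1) * (Fintype.card V - 2 - h) + h * (Fintype.card V - 1) := by
  rw [← SimpleGraph.sum_degrees_eq_twice_card_edges, ← Finset.sum_add_sum_compl Y,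
    ← Finset.sum_sdiff hXY]
  have h1 : ∑ v ∈ Y \ X, G.degree v ≤ (Y \ X).card • (Fintype.card V - 2 - h) :=
    Finset.sum_le_card_nsmul _ _ _ fun v hv => by
      have := hdY v (Finset.mem_sdiff.1 hv).1
      omega
  have h2 : ∑ v ∈ X, G.degree v ≤ X.card • h := Finset.sum_le_card_nsmul _ _ _ hdX
  have h3 : ∑ v ∈ Yᶜ, G.degree v ≤ Yᶜ.card • (Fintype.card V - 1) :=
    Finset.sum_le_card_nsmul _ _ _ fun v _ => by
      have := G.degree_lt_card_verts v
      omega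
  rw [Finset.card_sdiff_of_subset hXY, smul_eq_mul] at h1
  rw [hX, smul_eq_mul] at h2
  rw [Finset.card_compl, smul_eq_mul] at h3
  rw [show Y.card - X.card = Fintype.card V - 2 * h - 1 by omega] at h1
  rw [show Fintype.card V - Y.card = h by omega] at h3
  omega

end Counting

theorem choose_two_mul_two (n : ℕ) : 2 * n.choose 2 = n * (n - 1) := by
  rw [Nat.choose_two_right, Nat.mul_div_cancel' (Nat.even_mul_pred_self n).two_dvd]

/-- A dense graph which is not traceable has `h ≤ 1` in Chvátal's condition, unless it has
only eight vertices. -/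
theorem chvatal_index_le_one_or {n h e : ℕ} (hn : n = 8 ∨ 12 ≤ n) (hh : 2 * h + 2 ≤ n)
    (he : (n - 2).choose 2 + 1 ≤ e)
    (hle : 2 * e ≤ (h + 1) * h + (n - 2 * h - 1) * (n - 2 - h) + h * (n - 1)) :
    h ≤ 1 ∨ n = 8 ∧ (h = 3 ∨ h = 2 ∧ e = 16) := by
  rcases hn with rfl | hn
  -- At least 16 edges are present; the degree count allows at most 16 for `h = 2` and at most 18
  -- for `h = 3`.
  · rw [show Nat.choose (8 - 2) 2 = 15 by decide] at he
    have : h ≤ 3 := by omega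
    interval_cases h <;> simp at * ; omega
  · left
    by_contra! hlt
    have hc := choose_two_mul_two (n - 2)
    obtain ⟨s, rfl⟩ := Nat.exists_eq_add_of_le hh
    rw [show 2 * h + 2 + s - 2 * h - 1 = s + 1 by omega,
      show 2 * h + 2 + s - 2 - h = h + s by omega,
      show 2 * h + 2 + s - 1 = 2 * h + 1 + s by omega] at hle
    rw [show 2 * h + 2 + s - 2 = 2 * h + s by omega] at hc he
    obtain ⟨m, hm⟩ := Nat.exists_eq_add_of_le (show 1 ≤ 2 * h + s by omega)
    rw [hm, Nat.add_sub_cancel_left] at hc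
    have hm' : m = 2 * h + s - 1 := by omega
    obtain ⟨t, rfl⟩ := Nat.exists_eq_add_of_le hlt
    obtain rfl : m = 2 * t + 3 + s := by omega
    rw [hm] at he
    -- Here `h = t + 2` and the order is `2 * t + 6 + s`. For `t ≤ 2` the assumption that the order
    -- is at least 12 bounds `s` from below; for `t ≥ 3` it holds automatically.
    have h5 : t = 0 ∨ t = 1 ∨ t = 2 ∨ 3 ≤ t := by omega
    rcases h5 with rfl | rfl | rfl | h5
    · ring_nf at *; nlinarith
    · ring_nf at *; nlinarith
    · ring_nf at *; nlinarith
    · obtain ⟨r, rfl⟩ := Nat.exists_eq_add_of_le h5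
      ring_nf at *; nlinarith

/-- On n vertices, Chvátal's bounds would leave a total degree deficit of at least (h + 1)(2n - 3h -
2) > 4, while two missing edges account for only 4. -/
theorem traceable_of_card_edgeFinset_ge {V : Type*} [Fintype V] (G : SimpleGraph V)
    [DecidableRel G.Adj] (hV : 6 ≤ Fintype.card V)
    (he : (Fintype.card V).choose 2 ≤ G.edgeFinset.card + 2) : Traceable G := by
  classical
  by_contra hG
  obtain ⟨h, X, Y, hh, hXY, hX, hY, hdX, hdY⟩ := exists_degree_le_of_not_traceable hG
  have hle := two_mul_card_edgeFinset_le hh hXY hX hY hdX hdY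
  have hc := choose_two_mul_two (Fintype.card V)
  generalize Fintype.card V = n at *
  generalize G.edgeFinset.card = e at *
  obtain ⟨s, rfl⟩ := Nat.exists_eq_add_of_le hh
  rw [show 2 * h + 2 + s - 2 * h - 1 = s + 1 by omega,
    show 2 * h + 2 + s - 2 - h = h + s by omega,
    show 2 * h + 2 + s - 1 = 2 * h + 1 + s by omega] at hle
  rw [show 2 * h + 2 + s - 1 = 2 * h + 1 + s by omega] at hc
  obtain rfl | hh := Nat.eq_zero_or_pos h
  · ring_nf at *; nlinarith
  · ring_nf at *; nlinarith

end AntiRamsey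

/-! ### Rainbow copies from lists of vertices -/

namespace AntiRamsey

theorem hasRainbowCopy_of_isTransversal {V W : Type*} {c : (⊤ : SimpleGraph V).edgeSet → ℕ}
    {d : Sym2 V → ℕ} (hd : ∀ e, d e.1 = c e) {G : SimpleGraph V} (hG : IsTransversal d G)
    {H : SimpleGraph W} (h : H.IsContained G) : HasRainbowCopy c H := by
  obtain ⟨f⟩ := h
  refine ⟨(SimpleGraph.Copy.ofLE _ _ le_top).comp f, ?_⟩
  intro e₁ e₂ h12
  have h1 : ∀ e : H.edgeSet,
      c (((SimpleGraph.Copy.ofLE G ⊤ le_top).comp f).mapEdgeSet e) = d (f.mapEdgeSet e).1 := by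
    rintro ⟨e, he⟩
    induction e with | _ a b
    exact (hd _).symm
  simp only [h1] at h12
  exact f.mapEdgeSet.injective (Subtype.ext (hG.injOn (f.mapEdgeSet e₁).2 (f.mapEdgeSet e₂).2 h12))

/-- The list is cut into `k` blocks of length `m`, and no adjacency is asked for between blocks. The
vertex `x` is only the default of `getD`; all indices used are in range. -/
theorem isContained_copies_of_list {V : Type*} {G : SimpleGraph V} {k m : ℕ} (x : V) (l : List V)
    (hn : l.Nodup) (hlen : l.length = k * m)
    (h : ∀ i < k, ∀ j, j + 1 < m → G.Adj (l.getD (m * i + j) x) (l.getD (m * i + (j + 1)) x)) :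
    (copies k (SimpleGraph.pathGraph m)).IsContained G := by
  have hlt : ∀ p : Fin k × Fin m, m * p.1.1 + p.2.1 < l.length := by
    intro p
    rw [hlen, mul_comm k m]
    calc m * p.1.1 + p.2.1 < m * p.1.1 + m := by have := p.2.2; omega
      _ = m * (p.1.1 + 1) := by ring
      _ ≤ m * k := Nat.mul_le_mul_left _ p.1.2
  refine ⟨⟨⟨fun p => l.getD (m * p.1.1 + p.2.1) x, ?_⟩, ?_⟩⟩
  · rintro ⟨i, j⟩ ⟨i', j'⟩ ⟨h1, h2⟩
    simp only at h1 h2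
    subst h1
    rw [SimpleGraph.pathGraph_adj] at h2
    rcases h2 with h2 | h2
    · simpa [h2] using h i.1 i.2 j.1 (by omega)
    · simpa [h2] using (h i.1 i.2 j'.1 (by omega)).symm
  · intro p q hpq
    change l.getD _ x = l.getD _ x at hpq
    rw [List.getD_eq_getElem _ _ (hlt p), List.getD_eq_getElem _ _ (hlt q),
      hn.getElem_inj_iff] at hpq
    have h1 : p.1.1 = q.1.1 := by
      have hm : 0 < m := by have := p.2.2; omega
      have := congrArg (· / m) hpq
      simpa [Nat.mul_add_div hm, Nat.div_eq_of_lt p.2.2, Nat.div_eq_of_lt q.2.2] using this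
    rw [h1] at hpq
    exact Prod.ext (Fin.ext h1) (Fin.ext (by omega))

theorem Traceable.isContained_copies {V : Type*} [Fintype V] {G : SimpleGraph V}
    (hG : Traceable G) {k m : ℕ} (hV : Fintype.card V = k * m) :
    (copies k (SimpleGraph.pathGraph m)).IsContained G := by
  classical
  obtain ⟨l, hn, hm, hc⟩ := hG
  have hlen : l.length = k * m := by
    rw [← hV, ← List.toFinset_card_of_nodup hn, ← Finset.card_univ]
    congr 1
    ext w
    simpa using hm w
  obtain hV0 | ⟨⟨x⟩⟩ := isEmpty_or_nonempty V
  · obtain rfl : l = [] := by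
      cases l with
      | nil => rfl
      | cons a l => exact hV0.elim a
    have : IsEmpty (Fin k × Fin m) := by
      rw [← Fintype.card_eq_zero_iff]
      simpa using hlen.symm
    exact ⟨⟨⟨fun p => isEmptyElim p, fun {p} => isEmptyElim p⟩, fun p => isEmptyElim p⟩⟩
  · refine isContained_copies_of_list x l hn hlen fun i hi j hj => ?_
    have hlt : m * i + (j + 1) < l.length := by
      rw [hlen, mul_comm k m]
      calc m * i + (j + 1) < m * i + m := by omega
        _ = m * (i + 1) := by ring
        _ ≤ m * k := Nat.mul_le_mul_left _ hi
    rw [List.getD_eq_getElem _ _ hlt, List.getD_eq_getElem _ _ (by omega)]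
    exact List.isChain_iff_getElem.1 hc _ hlt

/-! ### Removing low-degree obstructions by exchange -/

section

open scoped Classical

variable {V : Type*} [Fintype V] {d : Sym2 V → ℕ} {G G' : SimpleGraph V}

theorem degree_le_of_swap {p q : V} {e : Sym2 V}
    (h : ∀ a b, G'.Adj a b ↔ s(a, b) = s(p, q) ∨ G.Adj a b ∧ s(a, b) ≠ e) {a : V}
    (hp : a ≠ p) (hq : a ≠ q) : G'.degree a ≤ G.degree a := by
  rw [← SimpleGraph.card_neighborFinset_eq_degree, ← SimpleGraph.card_neighborFinset_eq_degree]
  refine Finset.card_le_card fun b hb => ?_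
  rw [SimpleGraph.mem_neighborFinset, h, Sym2.eq_iff] at hb
  rw [SimpleGraph.mem_neighborFinset]
  tauto

theorem degree_le_add_one_of_swap {p q : V} {e : Sym2 V}
    (h : ∀ a b, G'.Adj a b ↔ s(a, b) = s(p, q) ∨ G.Adj a b ∧ s(a, b) ≠ e) (a : V) :
    G'.degree a ≤ G.degree a + 1 := by
  by_cases hp : a = p ∨ a = q
  · obtain ⟨b, hb⟩ : ∃ b, s(a, b) = s(p, q) := by
      rcases hp with rfl | rfl
      · exact ⟨q, rfl⟩
      · exact ⟨p, Sym2.eq_swap⟩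
    rw [← SimpleGraph.card_neighborFinset_eq_degree, ← SimpleGraph.card_neighborFinset_eq_degree]
    refine (Finset.card_le_card fun x hx => ?_).trans (Finset.card_insert_le b _)
    rw [SimpleGraph.mem_neighborFinset, h, ← hb, Sym2.congr_right] at hx
    rw [Finset.mem_insert, SimpleGraph.mem_neighborFinset]
    tauto
  · push Not at hp
    exact (degree_le_of_swap h hp.1 hp.2).trans (Nat.le_succ _)

theorem IsTransversal.card_edgeFinset_eq (hG : IsTransversal d G) (hG' : IsTransversal d G') :
    G.edgeFinset.card = G'.edgeFinset.card := by
  rw [hG.card_edgeFinset, hG'.card_edgeFinset]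

/-- The possible obstructions to traceability of a dense graph. -/
theorem not_traceable_cases (hV : Fintype.card V = 8 ∨ 12 ≤ Fintype.card V)
    (he : (Fintype.card V - 2).choose 2 + 1 ≤ G.edgeFinset.card) (hG : ¬ Traceable G) :
    (∃ x, G.degree x = 0) ∨ (∃ x y, x ≠ y ∧ G.degree x ≤ 1 ∧ G.degree y ≤ 1) ∨
    (Fintype.card V = 8 ∧ ∃ Y : Finset V, Y.card = 5 ∧ ∀ y ∈ Y, G.degree y ≤ 3) ∨
    (Fintype.card V = 8 ∧ G.edgeFinset.card = 16 ∧ ∃ X Y : Finset V, X ⊆ Y ∧ X.card = 3 ∧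
      Y.card = 6 ∧ (∀ x ∈ X, G.degree x ≤ 2) ∧ ∀ y ∈ Y, G.degree y ≤ 4) := by
  obtain ⟨h, X, Y, hh, hXY, hX, hY, hdX, hdY⟩ := exists_degree_le_of_not_traceable hG
  have hle := two_mul_card_edgeFinset_le hh hXY hX hY hdX hdY
  rcases chvatal_index_le_one_or hV hh he hle with h1 | ⟨h8, rfl | ⟨rfl, h16⟩⟩
  · obtain rfl | rfl : h = 0 ∨ h = 1 := by omega
    · obtain ⟨x, rfl⟩ := Finset.card_eq_one.1 hX
      exact Or.inl ⟨x, by simpa using hdX⟩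
    · obtain ⟨x, y, hxy, rfl⟩ := Finset.card_eq_two.1 hX
      exact Or.inr (Or.inl ⟨x, y, hxy, hdX x (by simp), hdX y (by simp)⟩)
  · exact Or.inr (Or.inr (Or.inl ⟨h8, Y, by omega, fun y hy => by have := hdY y hy; omega⟩))
  · exact Or.inr (Or.inr (Or.inr ⟨h8, h16, X, Y, hXY, hX, by omega, hdX,
      fun y hy => by have := hdY y hy; omega⟩))

theorem choose_two_sub_two {n : ℕ} (hn : 3 ≤ n) :
    (n - 2).choose 2 = (n - 3).choose 2 + (n - 3) := by
  obtain ⟨m, rfl⟩ := Nat.exists_eq_add_of_le' hn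
  rw [show m + 3 - 2 = m + 1 by omega, Nat.add_sub_cancel, Nat.choose_succ_succ', Nat.choose_one_right,
    add_comm]

/-- One exchange at an isolated vertex `v` suffices: a further isolated vertex `x` would leave at
most one edge meeting {v, x}, hence at most C(n-2, 2) + 1 edges in all. -/
theorem exists_isTransversal_degree_ne_zero
    (hV : 8 ≤ Fintype.card V) (hG : IsTransversal d G)
    (he : (Fintype.card V - 2).choose 2 + 2 ≤ G.edgeFinset.card) :
    ∃ G', IsTransversal d G' ∧ ∀ x, G'.degree x ≠ 0 := by
  by_cases h : ∃ v, G.degree v = 0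
  · obtain ⟨v, hv⟩ := h
    obtain ⟨w, hw⟩ := Fintype.exists_ne_of_one_lt_card (by omega) v
    obtain ⟨e, G', hG', hadj⟩ := hG.exists_swap hw.symm
    refine ⟨G', hG', fun x hx => ?_⟩
    have hv1 := degree_le_add_one_of_swap hadj v
    have hvx : v ≠ x := by
      rintro rfl
      rw [← SimpleGraph.card_neighborFinset_eq_degree, Finset.card_eq_zero] at hx
      have : w ∈ G'.neighborFinset v := by simp [hadj]
      simp [hx] at this
    have := card_edgeFinset_le_choose_add_sum_degree G' {v, x}
    rw [Finset.card_pair hvx, Finset.sum_pair hvx] at this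
    rw [hG.card_edgeFinset_eq hG'] at he
    omega
  · exact ⟨G, hG, by simpa using h⟩

theorem degree_pos_of_adj {x y : V} (h : G.Adj x y) : 0 < G.degree x := by
  rw [← SimpleGraph.card_neighborFinset_eq_degree]
  exact Finset.card_pos.2 ⟨y, by simpa using h⟩

/-- With sufficiently many colours some transversal has a Hamiltonian path, except possibly on
eight vertices. -/
theorem exists_isTransversal_traceable_or
    (hV : Fintype.card V = 8 ∨ 12 ≤ Fintype.card V) (hG : IsTransversal d G)
    (he : (Fintype.card V - 2).choose 2 + 2 ≤ G.edgeFinset.card) :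
    ∃ G', IsTransversal d G' ∧ (Traceable G' ∨
      Fintype.card V = 8 ∧ ∃ Y : Finset V, Y.card = 5 ∧ ∀ y ∈ Y, G'.degree y ≤ 3) := by
  obtain ⟨G₁, hG₁, h0⟩ := exists_isTransversal_degree_ne_zero (by omega) hG he
  rw [hG.card_edgeFinset_eq hG₁] at he
  by_cases ht : Traceable G₁
  · exact ⟨G₁, hG₁, Or.inl ht⟩
  rcases not_traceable_cases hV (by omega) ht with ⟨x, hx⟩ | ⟨x, y, hxy, hx, hy⟩ | h8 | ⟨h8, h16, -⟩
  · exact absurd hx (h0 x)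
  · obtain ⟨e, G₂, hG₂, hadj⟩ := hG₁.exists_swap hxy
    have hx2 := degree_le_add_one_of_swap hadj x
    have hy2 := degree_le_add_one_of_swap hadj y
    have hxyA : G₂.Adj x y := by simp [hadj]
    rw [hG₁.card_edgeFinset_eq hG₂] at he
    have hc := choose_two_sub_two (n := Fintype.card V) (by omega)
    -- Otherwise `z, x, y` have degree sum at most 1 + 2 + 2, too little against the loss of `card V
    -- - 3` in passing from C(n-2, 2) to C(n-3, 2).
    have key : ∀ z, z ≠ x → z ≠ y → 1 < G₂.degree z := by
      intro z hzx hzy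
      by_contra hz
      have := card_edgeFinset_le_choose_add_sum_degree G₂ {z, x, y}
      rw [Finset.card_eq_three.2 ⟨z, x, y, hzx, hzy, hxy, rfl⟩, Finset.sum_insert (by simp [hzx, hzy]),
        Finset.sum_pair hxy] at this
      omega
    by_cases ht : Traceable G₂
    · exact ⟨G₂, hG₂, Or.inl ht⟩
    refine ⟨G₂, hG₂, Or.inr ?_⟩
    rcases not_traceable_cases hV (by omega) ht with ⟨z, hz⟩ | ⟨z, w, hzw, hz, hw⟩ | h8 |
      ⟨h8, h16, -⟩
    · have h1 := degree_pos_of_adj hxyA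
      have h2 := degree_pos_of_adj hxyA.symm
      have h3 := key z (by rintro rfl; omega) (by rintro rfl; omega)
      omega
    · have hz' : z = x ∨ z = y := by
        by_contra! h
        have := key z h.1 h.2
        omega
      have hw' : w = x ∨ w = y := by
        by_contra! h
        have := key w h.1 h.2
        omega
      -- Then `xy` is the only edge meeting {x, y}, so there are at most C(n-2, 2) + 1 edges, one
      -- too few.
      have hd : G₂.degree x ≤ 1 ∧ G₂.degree y ≤ 1 := by
        rcases hz' with rfl | rfl <;> rcases hw' with rfl | rfl <;> tauto
      have := card_edgeFinset_lt_choose_add_of_adj hxyA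
      omega
    · exact h8
    · rw [h8, show Nat.choose (8 - 2) 2 = 15 by decide] at he
      omega
  · exact ⟨G₁, hG₁, Or.inr h8⟩
  · rw [h8, show Nat.choose (8 - 2) 2 = 15 by decide] at he
    omega

/-- At most three edges meet {x, y}, so the graph left after deleting both vertices lacks at most
two edges and has a Hamiltonian path. Its alternate edges together with `xy` form the matching. -/
theorem isContained_copies_pathGraph_two_of_degree_le {m : ℕ} (hV : Fintype.card V = 2 * m)
    (h8 : 8 ≤ Fintype.card V) (he : (Fintype.card V - 2).choose 2 + 1 ≤ G.edgeFinset.card)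
    {x y : V} (hxy : G.Adj x y) (hx : G.degree x ≤ 2) (hy : G.degree y ≤ 2) :
    (copies m (SimpleGraph.pathGraph 2)).IsContained G := by
  let J := G.induce {v | v ∉ ({x, y} : Finset V)}
  have h1 : G.edgeFinset.card < J.edgeFinset.card + (G.degree x + G.degree y) := by
    convert card_edgeFinset_lt_induce_compl_pair_add hxy
  have hcard : Fintype.card {v | v ∉ ({x, y} : Finset V)} = Fintype.card V - 2 := by
    have h2 : ∀ S : Finset V, Fintype.card {v // v ∉ S} = Fintype.card V - S.card :=
      fun S => by simp
    have h2 := h2 {x, y}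
    rw [Finset.card_pair hxy.ne] at h2
    exact h2
  have ht : Traceable J := by
    refine traceable_of_card_edgeFinset_ge J ?_ ?_
    · rw [hcard]; omega
    · rw [hcard]; omega
  obtain ⟨l, hn, hm, hc⟩ := ht
  have hlen : l.length = 2 * m - 2 := by
    rw [← hV, ← hcard, ← List.toFinset_card_of_nodup hn, ← Finset.card_univ]
    congr 1
    ext w
    simpa using hm w
  refine isContained_copies_of_list x (x :: y :: l.map Subtype.val) ?_ (by simp; omega) ?_
  · have h3 : ∀ z, z ∈ l.map Subtype.val → z ≠ x ∧ z ≠ y := by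
      intro z hz
      obtain ⟨⟨w, hw⟩, -, rfl⟩ := List.mem_map.1 hz
      simpa using hw
    rw [List.nodup_cons, List.nodup_cons]
    refine ⟨fun h => ?_, fun h => (h3 y h).2 rfl, hn.map Subtype.val_injective⟩
    rcases List.mem_cons.1 h with h | h
    · exact hxy.ne h
    · exact (h3 x h).1 rfl
  · intro i hi j hj
    obtain rfl : j = 0 := by omega
    cases i with
    | zero => simpa using hxy
    | succ i =>
      have hlt : 2 * i + 1 < l.length := by omega
      have h4 : G.Adj l[2 * i].1 l[2 * i + 1].1 := List.isChain_iff_getElem.1 hc _ hlt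
      simpa [Nat.mul_add, List.getD_eq_getElem?_getD, hlt, (Nat.lt_succ_self _).trans hlt]
        using h4
theorem exists_isTransversal_isContained_of_degree_le_one {m : ℕ} (hV : Fintype.card V = 2 * m)
    (h8 : 8 ≤ Fintype.card V) (hG : IsTransversal d G)
    (he : (Fintype.card V - 2).choose 2 + 1 ≤ G.edgeFinset.card)
    {x y : V} (hxy : x ≠ y) (hx : G.degree x ≤ 1) (hy : G.degree y ≤ 1) :
    ∃ G', IsTransversal d G' ∧ (copies m (SimpleGraph.pathGraph 2)).IsContained G' := by
  obtain ⟨e, G', hG', hadj⟩ := hG.exists_swap hxy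
  have hx2 := degree_le_add_one_of_swap hadj x
  have hy2 := degree_le_add_one_of_swap hadj y
  rw [hG.card_edgeFinset_eq hG'] at he
  exact ⟨G', hG', isContained_copies_pathGraph_two_of_degree_le hV h8 he
    (show G'.Adj x y by simp [hadj]) (by omega) (by omega)⟩

/-- With sufficiently many colours some transversal has a perfect matching, except possibly on
eight vertices. -/
theorem exists_isTransversal_matching_or {m : ℕ} (hm : Fintype.card V = 2 * m)
    (hV : Fintype.card V = 8 ∨ 12 ≤ Fintype.card V) (hG : IsTransversal d G)
    (he : (Fintype.card V - 2).choose 2 + 1 ≤ G.edgeFinset.card) :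
    ∃ G', IsTransversal d G' ∧ ((copies m (SimpleGraph.pathGraph 2)).IsContained G' ∨
      (Fintype.card V = 8 ∧ ∃ Y : Finset V, Y.card = 5 ∧ ∀ y ∈ Y, G'.degree y ≤ 3) ∨
      (Fintype.card V = 8 ∧ G'.edgeFinset.card = 16 ∧ ∃ X Y : Finset V, X ⊆ Y ∧ X.card = 3 ∧
        Y.card = 6 ∧ (∀ x ∈ X, G'.degree x ≤ 2) ∧ ∀ y ∈ Y, G'.degree y ≤ 4)) := by
  by_cases ht : Traceable G
  · exact ⟨G, hG, Or.inl (ht.isContained_copies (by omega))⟩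
  rcases not_traceable_cases hV he ht with ⟨v, hv⟩ | ⟨x, y, hxy, hx, hy⟩ | h
  · obtain ⟨w, hw⟩ := Fintype.exists_ne_of_one_lt_card (by omega) v
    obtain ⟨e, G', hG', hadj⟩ := hG.exists_swap hw.symm
    have hv1 := degree_le_add_one_of_swap hadj v
    have hv0 : 0 < G'.degree v := degree_pos_of_adj (show G'.Adj v w by simp [hadj])
    have he' := he
    rw [hG.card_edgeFinset_eq hG'] at he'
    by_cases ht' : Traceable G'
    · exact ⟨G', hG', Or.inl (ht'.isContained_copies (by omega))⟩
    rcases not_traceable_cases hV he' ht' with ⟨z, hz⟩ | ⟨x, y, hxy, hx, hy⟩ | h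
    -- The repaired vertex `v` has degree 1 and the newly isolated `z` has degree 0, so they form a
    -- pair of low vertices.
    · obtain ⟨G₂, hG₂, h₂⟩ := exists_isTransversal_isContained_of_degree_le_one hm (by omega) hG' he'
        (show v ≠ z by rintro rfl; omega) (by omega) (by omega)
      exact ⟨G₂, hG₂, Or.inl h₂⟩
    · obtain ⟨G₂, hG₂, h₂⟩ := exists_isTransversal_isContained_of_degree_le_one hm (by omega) hG' he'
        hxy hx hy
      exact ⟨G₂, hG₂, Or.inl h₂⟩
    · exact ⟨G', hG', Or.inr h⟩
  · obtain ⟨G₂, hG₂, h₂⟩ := exists_isTransversal_isContained_of_degree_le_one hm (by omega) hG he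
      hxy hx hy
    exact ⟨G₂, hG₂, Or.inl h₂⟩
  · exact ⟨G, hG, Or.inr h⟩

end

end AntiRamsey

/-! ### Graphs on eight labelled vertices -/

namespace AntiRamsey

open scoped Classical

variable {V : Type*} {d : Sym2 V → ℕ} {G G' : SimpleGraph V}

/-- The adjacency matrix of a graph on eight labelled vertices. -/
noncomputable def adjInd (G : SimpleGraph V) (σ : Fin 8 ≃ V) (i j : Fin 8) : ℕ :=
  if G.Adj (σ i) (σ j) then 1 else 0

theorem adjInd_comm (G : SimpleGraph V) (σ : Fin 8 ≃ V) (i j : Fin 8) :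
    adjInd G σ i j = adjInd G σ j i := by
  simp [adjInd, SimpleGraph.adj_comm]

theorem adjInd_self (G : SimpleGraph V) (σ : Fin 8 ≃ V) (i : Fin 8) : adjInd G σ i i = 0 := by
  simp [adjInd]

theorem adjInd_le_one (G : SimpleGraph V) (σ : Fin 8 ≃ V) (i j : Fin 8) :
    adjInd G σ i j ≤ 1 := by
  unfold adjInd
  split_ifs <;> simp

theorem adj_of_adjInd {σ : Fin 8 ≃ V} {i j : Fin 8} (h : 0 < adjInd G σ i j) :
    G.Adj (σ i) (σ j) := by
  by_contra hn
  simp [adjInd, hn] at h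

theorem adjInd_le_of_imp {σ : Fin 8 ≃ V} {i j : Fin 8}
    (h : G'.Adj (σ i) (σ j) → G.Adj (σ i) (σ j)) : adjInd G' σ i j ≤ adjInd G σ i j := by
  unfold adjInd
  split_ifs <;> simp_all

theorem degree_eq_sum_adjInd [Fintype V] (G : SimpleGraph V) (σ : Fin 8 ≃ V) (i : Fin 8) :
    G.degree (σ i) = ∑ j, adjInd G σ i j := by
  rw [← SimpleGraph.card_neighborFinset_eq_degree, SimpleGraph.neighborFinset_eq_filter,
    Finset.card_filter, ← Equiv.sum_comp σ]
  rfl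

/-- Using only the 28 indicators with first index below the second turns the eight-vertex cases into
linear arithmetic. -/
theorem degree_expansion [Fintype V] (G : SimpleGraph V) (σ : Fin 8 ≃ V) :
    G.degree (σ 0) = adjInd G σ 0 1 + adjInd G σ 0 2 + adjInd G σ 0 3 + adjInd G σ 0 4 + adjInd G σ
      0 5 + adjInd G σ 0 6 + adjInd G σ 0 7 ∧
    G.degree (σ 1) = adjInd G σ 0 1 + adjInd G σ 1 2 + adjInd G σ 1 3 + adjInd G σ 1 4 + adjInd G σ
      1 5 + adjInd G σ 1 6 + adjInd G σ 1 7 ∧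
    G.degree (σ 2) = adjInd G σ 0 2 + adjInd G σ 1 2 + adjInd G σ 2 3 + adjInd G σ 2 4 + adjInd G σ
      2 5 + adjInd G σ 2 6 + adjInd G σ 2 7 ∧
    G.degree (σ 3) = adjInd G σ 0 3 + adjInd G σ 1 3 + adjInd G σ 2 3 + adjInd G σ 3 4 + adjInd G σ
      3 5 + adjInd G σ 3 6 + adjInd G σ 3 7 ∧
    G.degree (σ 4) = adjInd G σ 0 4 + adjInd G σ 1 4 + adjInd G σ 2 4 + adjInd G σ 3 4 + adjInd G σ
      4 5 + adjInd G σ 4 6 + adjInd G σ 4 7 ∧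
    G.degree (σ 5) = adjInd G σ 0 5 + adjInd G σ 1 5 + adjInd G σ 2 5 + adjInd G σ 3 5 + adjInd G σ
      4 5 + adjInd G σ 5 6 + adjInd G σ 5 7 ∧
    G.degree (σ 6) = adjInd G σ 0 6 + adjInd G σ 1 6 + adjInd G σ 2 6 + adjInd G σ 3 6 + adjInd G σ
      4 6 + adjInd G σ 5 6 + adjInd G σ 6 7 ∧
    G.degree (σ 7) = adjInd G σ 0 7 + adjInd G σ 1 7 + adjInd G σ 2 7 + adjInd G σ 3 7 + adjInd G σ
      4 7 + adjInd G σ 5 7 + adjInd G σ 6 7 := by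
  simp only [degree_eq_sum_adjInd, Fin.sum_univ_eight, adjInd_self]
  simp only [adjInd_comm G σ 1 0, adjInd_comm G σ 2 0, adjInd_comm G σ 3 0, adjInd_comm G σ 4 0, adjInd_comm
    G σ 5 0, adjInd_comm G σ 6 0, adjInd_comm G σ 7 0, adjInd_comm G σ 2 1, adjInd_comm G σ 3 1,
    adjInd_comm G σ 4 1, adjInd_comm G σ 5 1, adjInd_comm G σ 6 1, adjInd_comm G σ 7 1,
    adjInd_comm G σ 3 2, adjInd_comm G σ 4 2, adjInd_comm G σ 5 2, adjInd_comm G σ 6 2,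
    adjInd_comm G σ 7 2, adjInd_comm G σ 4 3, adjInd_comm G σ 5 3, adjInd_comm G σ 6 3,
    adjInd_comm G σ 7 3, adjInd_comm G σ 5 4, adjInd_comm G σ 6 4, adjInd_comm G σ 7 4,
    adjInd_comm G σ 6 5, adjInd_comm G σ 7 5, adjInd_comm G σ 7 6]
  simp

theorem card_edgeFinset_expansion [Fintype V] (G : SimpleGraph V) (σ : Fin 8 ≃ V) :
    G.edgeFinset.card = adjInd G σ 0 1 + adjInd G σ 0 2 + adjInd G σ 0 3 + adjInd G σ 0 4 + adjInd G
      σ 0 5 + adjInd G σ 0 6 + adjInd G σ 0 7 + adjInd G σ 1 2 + adjInd G σ 1 3 + adjInd G σ 1 4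
      + adjInd G σ 1 5 + adjInd G σ 1 6 + adjInd G σ 1 7 + adjInd G σ 2 3 + adjInd G σ 2 4 +
      adjInd G σ 2 5 + adjInd G σ 2 6 + adjInd G σ 2 7 + adjInd G σ 3 4 + adjInd G σ 3 5 +
      adjInd G σ 3 6 + adjInd G σ 3 7 + adjInd G σ 4 5 + adjInd G σ 4 6 + adjInd G σ 4 7 +
      adjInd G σ 5 6 + adjInd G σ 5 7 + adjInd G σ 6 7 := by
  have h := SimpleGraph.sum_degrees_eq_twice_card_edges G
  rw [← Equiv.sum_comp σ, Fin.sum_univ_eight] at h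
  obtain ⟨h0, h1, h2, h3, h4, h5, h6, h7⟩ := degree_expansion G σ
  omega

end AntiRamsey

/-! ### Eight vertices, five of degree at most three -/

namespace AntiRamsey

open scoped Classical

variable {V : Type*} {d : Sym2 V → ℕ} {G G' : SimpleGraph V}

theorem exists_equiv_of_nodup [Fintype V] (hV : Fintype.card V = 8) {l : List V} (hn : l.Nodup)
    (hl : l.length = 8) (x : V) : ∃ σ : Fin 8 ≃ V, ∀ i, σ i = l.getD i x := by
  have hinj : Function.Injective fun i : Fin 8 => l.getD i x := by
    intro i j hij
    have hi : i.1 < l.length := by omega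
    have hj : j.1 < l.length := by omega
    simp only [List.getD_eq_getElem _ _ hi, List.getD_eq_getElem _ _ hj,
      hn.getElem_inj_iff] at hij
    exact Fin.ext hij
  exact ⟨Equiv.ofBijective _ ((Fintype.bijective_iff_injective_and_card _).2
    ⟨hinj, by simp [hV]⟩), fun i => rfl⟩

theorem exists_labelling [Fintype V] (hV : Fintype.card V = 8) {Y : Finset V} (hY : Y.card = 5)
    {b₁ b₂ : V} (h1 : b₁ ∈ Y) (h2 : b₂ ∈ Y) (h12 : b₁ ≠ b₂) :
    ∃ σ : Fin 8 ≃ V, σ 3 = b₁ ∧ σ 4 = b₂ ∧ σ 5 ∈ Y ∧ σ 6 ∈ Y ∧ σ 7 ∈ Y := by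
  have hA : Yᶜ.card = 3 := by rw [Finset.card_compl, hV, hY]
  have hB : ((Y.erase b₁).erase b₂).card = 3 := by
    rw [Finset.card_erase_of_mem (Finset.mem_erase.2 ⟨h12.symm, h2⟩),
      Finset.card_erase_of_mem h1, hY]
  obtain ⟨a₁, a₂, a₃, ha12, ha13, ha23, hA⟩ := Finset.card_eq_three.1 hA
  obtain ⟨b₃, b₄, b₅, hb34, hb35, hb45, hB⟩ := Finset.card_eq_three.1 hB
  have hA' : ∀ a ∈ ({a₁, a₂, a₃} : Finset V), a ∉ Y := fun a ha => by
    rw [← hA] at ha; simpa using ha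
  have hB' : ∀ b ∈ ({b₃, b₄, b₅} : Finset V), b ≠ b₂ ∧ b ≠ b₁ ∧ b ∈ Y := fun b hb => by
    rw [← hB] at hb; simpa using hb
  simp only [Finset.mem_insert, Finset.mem_singleton, forall_eq_or_imp, forall_eq] at hA' hB'
  obtain ⟨σ, hσ⟩ := exists_equiv_of_nodup hV (l := [a₁, a₂, a₃, b₁, b₂, b₃, b₄, b₅])
    (by simp only [List.nodup_cons, List.mem_cons, not_or]; constructorm* _ ∧ _ <;> grind) rfl b₁
  exact ⟨σ, hσ 3, hσ 4, (hσ 5).symm ▸ hB'.1.2.2, (hσ 6).symm ▸ hB'.2.1.2.2,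
    (hσ 7).symm ▸ hB'.2.2.2.2⟩

theorem isContained_two_copies_pathGraph_four {σ : Fin 8 ≃ V} {l : List (Fin 8)}
    (hl : l.Nodup) (h8 : l.length = 8)
    (h : ∀ i < 2, ∀ j, j + 1 < 4 → G.Adj (σ (l.getD (4 * i + j) 0)) (σ (l.getD (4 * i + (j + 1)) 0))) :
    (copies 2 (SimpleGraph.pathGraph 4)).IsContained G := by
  refine isContained_copies_of_list (σ 0) (l.map σ) (hl.map σ.injective) (by simpa using h8) ?_
  intro i hi j hj
  rw [List.getD_map, List.getD_map]
  exact h i hi j hj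

theorem isContained_four_copies_pathGraph_two {σ : Fin 8 ≃ V} {l : List (Fin 8)}
    (hl : l.Nodup) (h8 : l.length = 8)
    (h : ∀ i < 4, G.Adj (σ (l.getD (2 * i) 0)) (σ (l.getD (2 * i + 1) 0))) :
    (copies 4 (SimpleGraph.pathGraph 2)).IsContained G := by
  refine isContained_copies_of_list (σ 0) (l.map σ) (hl.map σ.injective) (by simpa using h8) ?_
  intro i hi j hj
  obtain rfl : j = 0 := by omega
  rw [List.getD_map, List.getD_map]
  exact h i hi

/-- Two disjoint four-vertex paths, one of which starts with the edge `{3, 4}`, in an almost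
complete bipartite graph between `{0, 1, 2}` and `{4, 5, 6, 7}`. -/
theorem isContained_two_copies_pathGraph_four_of_adjInd {σ : Fin 8 ≃ V} (h34 : G.Adj (σ 3) (σ 4))
    (h : 11 ≤ adjInd G σ 0 4 + adjInd G σ 0 5 + adjInd G σ 0 6 + adjInd G σ 0 7 +
      adjInd G σ 1 4 + adjInd G σ 1 5 + adjInd G σ 1 6 + adjInd G σ 1 7 +
      adjInd G σ 2 4 + adjInd G σ 2 5 + adjInd G σ 2 6 + adjInd G σ 2 7) :
    (copies 2 (SimpleGraph.pathGraph 4)).IsContained G := by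
  have hle := adjInd_le_one G σ
  have h04 := hle 0 4
  have h05 := hle 0 5
  have h06 := hle 0 6
  have h07 := hle 0 7
  have h14 := hle 1 4
  have h15 := hle 1 5
  have h16 := hle 1 6
  have h17 := hle 1 7
  have h24 := hle 2 4
  have h25 := hle 2 5
  have h26 := hle 2 6
  have h27 := hle 2 7
  -- At most one of the twelve pairs is missing, and the two systems of edges are disjoint, so one
  -- of them is complete.
  rcases (by omega : (0 < adjInd G σ 0 4 ∧ 0 < adjInd G σ 0 5 ∧ 0 < adjInd G σ 1 6 ∧
      0 < adjInd G σ 1 7 ∧ 0 < adjInd G σ 2 7) ∨ (0 < adjInd G σ 1 4 ∧ 0 < adjInd G σ 1 5 ∧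
      0 < adjInd G σ 0 7 ∧ 0 < adjInd G σ 0 6 ∧ 0 < adjInd G σ 2 6)) with h | h
  · refine isContained_two_copies_pathGraph_four (σ := σ) (l := [3, 4, 0, 5, 6, 1, 7, 2])
      (by decide) rfl fun i hi j hj => ?_
    obtain ⟨h1, h2, h3, h4, h5⟩ := h
    have hj' : j < 3 := by omega
    interval_cases i <;> interval_cases j
    exacts [h34, (adj_of_adjInd h1).symm, adj_of_adjInd h2, (adj_of_adjInd h3).symm,
      adj_of_adjInd h4, (adj_of_adjInd h5).symm]
  · refine isContained_two_copies_pathGraph_four (σ := σ) (l := [3, 4, 1, 5, 7, 0, 6, 2])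
      (by decide) rfl fun i hi j hj => ?_
    obtain ⟨h1, h2, h3, h4, h5⟩ := h
    have hj' : j < 3 := by omega
    interval_cases i <;> interval_cases j
    exacts [h34, (adj_of_adjInd h1).symm, adj_of_adjInd h2, (adj_of_adjInd h3).symm,
      adj_of_adjInd h4, (adj_of_adjInd h5).symm]

/-- A perfect matching containing the edge `{3, 4}`, in an almost complete bipartite graph
between `{0, 1, 2}` and `{5, 6, 7}`. -/
theorem isContained_four_copies_pathGraph_two_of_adjInd {σ : Fin 8 ≃ V} (h34 : G.Adj (σ 3) (σ 4))
    (h : 7 ≤ adjInd G σ 0 5 + adjInd G σ 0 6 + adjInd G σ 0 7 +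
      adjInd G σ 1 5 + adjInd G σ 1 6 + adjInd G σ 1 7 +
      adjInd G σ 2 5 + adjInd G σ 2 6 + adjInd G σ 2 7) :
    (copies 4 (SimpleGraph.pathGraph 2)).IsContained G := by
  have hle := adjInd_le_one G σ
  have h05 := hle 0 5
  have h06 := hle 0 6
  have h07 := hle 0 7
  have h15 := hle 1 5
  have h16 := hle 1 6
  have h17 := hle 1 7
  have h25 := hle 2 5
  have h26 := hle 2 6
  have h27 := hle 2 7
  -- At most two of the nine pairs are missing, and the three matchings are disjoint.
  rcases (by omega : (0 < adjInd G σ 0 5 ∧ 0 < adjInd G σ 1 6 ∧ 0 < adjInd G σ 2 7) ∨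
      (0 < adjInd G σ 0 6 ∧ 0 < adjInd G σ 1 7 ∧ 0 < adjInd G σ 2 5) ∨
      (0 < adjInd G σ 0 7 ∧ 0 < adjInd G σ 1 5 ∧ 0 < adjInd G σ 2 6)) with h | h | h
  · refine isContained_four_copies_pathGraph_two (σ := σ) (l := [3, 4, 0, 5, 1, 6, 2, 7])
      (by decide) rfl fun i hi => ?_
    interval_cases i
    exacts [h34, adj_of_adjInd h.1, adj_of_adjInd h.2.1, adj_of_adjInd h.2.2]
  · refine isContained_four_copies_pathGraph_two (σ := σ) (l := [3, 4, 0, 6, 1, 7, 2, 5])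
      (by decide) rfl fun i hi => ?_
    interval_cases i
    exacts [h34, adj_of_adjInd h.1, adj_of_adjInd h.2.1, adj_of_adjInd h.2.2]
  · refine isContained_four_copies_pathGraph_two (σ := σ) (l := [3, 4, 0, 7, 1, 5, 2, 6])
      (by decide) rfl fun i hi => ?_
    interval_cases i
    exacts [h34, adj_of_adjInd h.1, adj_of_adjInd h.2.1, adj_of_adjInd h.2.2]

/-- The bipartite graph between `{0, 1, 2}` and the rest which remains after five vertices of low
degree, two of which are adjacent, have been labelled `3, …, 7`. -/
theorem le_sum_adjInd_of_degree_le [Fintype V] {σ : Fin 8 ≃ V} (he : 16 ≤ G.edgeFinset.card)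
    (hσ : G.Adj (σ 3) (σ 4)) (h3 : G.degree (σ 3) ≤ 3) (h4 : G.degree (σ 4) ≤ 3)
    (h5 : G.degree (σ 5) ≤ 3) (h6 : G.degree (σ 6) ≤ 3) (h7 : G.degree (σ 7) ≤ 3) :
    (17 ≤ G.edgeFinset.card → 11 ≤ adjInd G σ 0 4 + adjInd G σ 0 5 + adjInd G σ 0 6 + adjInd G σ 0 7 + adjInd G σ 1 4 + adjInd
        G σ 1 5 + adjInd G σ 1 6 + adjInd G σ 1 7 + adjInd G σ 2 4 + adjInd G σ 2 5 + adjInd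
        G σ 2 6 + adjInd G σ 2 7) ∧
      7 ≤ adjInd G σ 0 5 + adjInd G σ 0 6 + adjInd G σ 0 7 + adjInd G σ 1 5 + adjInd G σ 1 6 + adjInd
        G σ 1 7 + adjInd G σ 2 5 + adjInd G σ 2 6 + adjInd G σ 2 7 := by
  have h34 : adjInd G σ 3 4 = 1 := by simp [adjInd, hσ]
  have hc := card_edgeFinset_expansion G σ
  obtain ⟨-, -, -, d3, d4, d5, d6, d7⟩ := degree_expansion G σ
  -- With A = {0, 1, 2}, B the rest and e edges in all, e(A) ≤ 3 and e(A, B) + 2e(B) ≤ 15 give e(B)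
  -- ≤ 18 - e. Since 3 and 4 are adjacent, each sends at most two edges to A.
  constructor
  · intro he
    linarith [adjInd_le_one G σ 0 1, adjInd_le_one G σ 0 2, adjInd_le_one G σ 0 3, adjInd_le_one G σ 0 4,
      adjInd_le_one G σ 0 5, adjInd_le_one G σ 0 6, adjInd_le_one G σ 0 7, adjInd_le_one G σ 1 2,
      adjInd_le_one G σ 1 3, adjInd_le_one G σ 1 4, adjInd_le_one G σ 1 5, adjInd_le_one G σ 1 6,
      adjInd_le_one G σ 1 7, adjInd_le_one G σ 2 3, adjInd_le_one G σ 2 4, adjInd_le_one G σ 2 5,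
      adjInd_le_one G σ 2 6, adjInd_le_one G σ 2 7]
  · linarith [adjInd_le_one G σ 0 1, adjInd_le_one G σ 0 2, adjInd_le_one G σ 0 3, adjInd_le_one G σ 0 4,
      adjInd_le_one G σ 0 5, adjInd_le_one G σ 0 6, adjInd_le_one G σ 0 7, adjInd_le_one G σ 1 2,
      adjInd_le_one G σ 1 3, adjInd_le_one G σ 1 4, adjInd_le_one G σ 1 5, adjInd_le_one G σ 1 6,
      adjInd_le_one G σ 1 7, adjInd_le_one G σ 2 3, adjInd_le_one G σ 2 4, adjInd_le_one G σ 2 5,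
      adjInd_le_one G σ 2 6, adjInd_le_one G σ 2 7]

/-- The same conclusion after an independent set of five vertices has received the edge `{3, 4}`
in exchange for some other edge. -/
theorem le_sum_adjInd_of_swap [Fintype V] {σ : Fin 8 ≃ V} {e : Sym2 V}
    (he : 16 ≤ G.edgeFinset.card) (hcard : G.edgeFinset.card = G'.edgeFinset.card)
    (hadj : ∀ a b, G'.Adj a b ↔ s(a, b) = s(σ 3, σ 4) ∨ G.Adj a b ∧ s(a, b) ≠ e)
    (hind : ∀ i j, 3 ≤ i → 3 ≤ j → adjInd G σ i j = 0)
    (hdeg : G.degree (σ 3) ≤ 2 ∨ ∀ i, 3 ≤ i → 3 ≤ G.degree (σ i)) :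
    (17 ≤ G.edgeFinset.card → 11 ≤ adjInd G' σ 0 4 + adjInd G' σ 0 5 + adjInd G' σ 0 6 + adjInd G' σ 0 7 + adjInd G' σ 1 4 + adjInd
        G' σ 1 5 + adjInd G' σ 1 6 + adjInd G' σ 1 7 + adjInd G' σ 2 4 + adjInd G' σ 2 5 + adjInd
        G' σ 2 6 + adjInd G' σ 2 7) ∧
      7 ≤ adjInd G' σ 0 5 + adjInd G' σ 0 6 + adjInd G' σ 0 7 + adjInd G' σ 1 5 + adjInd G' σ 1 6 + adjInd
        G' σ 1 7 + adjInd G' σ 2 5 + adjInd G' σ 2 6 + adjInd G' σ 2 7 := by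
  have H : ∀ i j, s(i, j) ≠ s(3, 4) → adjInd G' σ i j ≤ adjInd G σ i j := by
    intro i j hij
    refine adjInd_le_of_imp fun h => ?_
    rcases (hadj _ _).1 h with h | h
    · rw [Sym2.eq_iff] at h
      simp only [σ.injective.eq_iff] at h
      exact absurd (Sym2.eq_iff.2 h) hij
    · exact h.1
  have hc := card_edgeFinset_expansion G σ
  have hc' := card_edgeFinset_expansion G' σ
  obtain ⟨-, -, -, d3, d4, d5, d6, d7⟩ := degree_expansion G σ
  have h34 : adjInd G' σ 3 4 = 1 := by simp [adjInd, hadj]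
  have z34 := hind 3 4 (by decide) (by decide)
  have z35 := hind 3 5 (by decide) (by decide)
  have z36 := hind 3 6 (by decide) (by decide)
  have z37 := hind 3 7 (by decide) (by decide)
  have z45 := hind 4 5 (by decide) (by decide)
  have z46 := hind 4 6 (by decide) (by decide)
  have z47 := hind 4 7 (by decide) (by decide)
  have z56 := hind 5 6 (by decide) (by decide)
  have z57 := hind 5 7 (by decide) (by decide)
  have z67 := hind 6 7 (by decide) (by decide)
  -- If vertex 3 has degree at most 2, then at least e - 4 edges of the new graph run between {0, 1,
  -- 2} and the rest, at most two of them at 3 and three at 4. Otherwise that bipartite graph was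
  -- complete and has lost at most one edge.
  rcases hdeg with hdeg | hdeg
  · constructor
    · intro he
      linarith [H 0 1 (by decide), H 0 2 (by decide), H 0 3 (by decide), H 0 4 (by decide), H 0 5 (by decide), H 0
        6 (by decide), H 0 7 (by decide), H 1 2 (by decide), H 1 3 (by decide), H 1 4 (by decide),
        H 1 5 (by decide), H 1 6 (by decide), H 1 7 (by decide), H 2 3 (by decide), H 2 4 (by
        decide), H 2 5 (by decide), H 2 6 (by decide), H 2 7 (by decide), H 3 5 (by decide), H 3 6
        (by decide), H 3 7 (by decide), H 4 5 (by decide), H 4 6 (by decide), H 4 7 (by decide), H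
        5 6 (by decide), H 5 7 (by decide), H 6 7 (by decide),
        adjInd_le_one G' σ 0 1, adjInd_le_one G' σ 0 2, adjInd_le_one G' σ 1 2, adjInd_le_one G' σ 0 3,
        adjInd_le_one G' σ 0 4, adjInd_le_one G' σ 1 3, adjInd_le_one G' σ 1 4, adjInd_le_one G' σ
        2 3, adjInd_le_one G' σ 2 4]
    · linarith [H 0 1 (by decide), H 0 2 (by decide), H 0 3 (by decide), H 0 4 (by decide), H 0 5 (by decide), H 0
        6 (by decide), H 0 7 (by decide), H 1 2 (by decide), H 1 3 (by decide), H 1 4 (by decide),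
        H 1 5 (by decide), H 1 6 (by decide), H 1 7 (by decide), H 2 3 (by decide), H 2 4 (by
        decide), H 2 5 (by decide), H 2 6 (by decide), H 2 7 (by decide), H 3 5 (by decide), H 3 6
        (by decide), H 3 7 (by decide), H 4 5 (by decide), H 4 6 (by decide), H 4 7 (by decide), H
        5 6 (by decide), H 5 7 (by decide), H 6 7 (by decide),
        adjInd_le_one G' σ 0 1, adjInd_le_one G' σ 0 2, adjInd_le_one G' σ 1 2, adjInd_le_one G' σ 0 3,
        adjInd_le_one G' σ 0 4, adjInd_le_one G' σ 1 3, adjInd_le_one G' σ 1 4, adjInd_le_one G' σ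
        2 3, adjInd_le_one G' σ 2 4]
  · have k3 := hdeg 3 (by decide)
    have k4 := hdeg 4 (by decide)
    have k5 := hdeg 5 (by decide)
    have k6 := hdeg 6 (by decide)
    have k7 := hdeg 7 (by decide)
    constructor
    · intro he
      linarith [H 0 1 (by decide), H 0 2 (by decide), H 0 3 (by decide), H 0 4 (by decide), H 0 5 (by decide), H 0
        6 (by decide), H 0 7 (by decide), H 1 2 (by decide), H 1 3 (by decide), H 1 4 (by decide),
        H 1 5 (by decide), H 1 6 (by decide), H 1 7 (by decide), H 2 3 (by decide), H 2 4 (by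
        decide), H 2 5 (by decide), H 2 6 (by decide), H 2 7 (by decide), H 3 5 (by decide), H 3 6
        (by decide), H 3 7 (by decide), H 4 5 (by decide), H 4 6 (by decide), H 4 7 (by decide), H
        5 6 (by decide), H 5 7 (by decide), H 6 7 (by decide),
        adjInd_le_one G σ 0 3, adjInd_le_one G σ 0 4, adjInd_le_one G σ 0 5, adjInd_le_one G σ 0 6,
        adjInd_le_one G σ 0 7, adjInd_le_one G σ 1 3, adjInd_le_one G σ 1 4, adjInd_le_one G σ 1
        5, adjInd_le_one G σ 1 6, adjInd_le_one G σ 1 7, adjInd_le_one G σ 2 3, adjInd_le_one G σ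
        2 4, adjInd_le_one G σ 2 5, adjInd_le_one G σ 2 6, adjInd_le_one G σ 2 7, adjInd_le_one G' σ 0 1, adjInd_le_one G' σ 0 2, adjInd_le_one G' σ 1 2, adjInd_le_one G' σ 0 3,
        adjInd_le_one G' σ 0 4, adjInd_le_one G' σ 1 3, adjInd_le_one G' σ 1 4, adjInd_le_one G' σ
        2 3, adjInd_le_one G' σ 2 4]
    · linarith [H 0 1 (by decide), H 0 2 (by decide), H 0 3 (by decide), H 0 4 (by decide), H 0 5 (by decide), H 0
        6 (by decide), H 0 7 (by decide), H 1 2 (by decide), H 1 3 (by decide), H 1 4 (by decide),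
        H 1 5 (by decide), H 1 6 (by decide), H 1 7 (by decide), H 2 3 (by decide), H 2 4 (by
        decide), H 2 5 (by decide), H 2 6 (by decide), H 2 7 (by decide), H 3 5 (by decide), H 3 6
        (by decide), H 3 7 (by decide), H 4 5 (by decide), H 4 6 (by decide), H 4 7 (by decide), H
        5 6 (by decide), H 5 7 (by decide), H 6 7 (by decide),
        adjInd_le_one G σ 0 3, adjInd_le_one G σ 0 4, adjInd_le_one G σ 0 5, adjInd_le_one G σ 0 6,
        adjInd_le_one G σ 0 7, adjInd_le_one G σ 1 3, adjInd_le_one G σ 1 4, adjInd_le_one G σ 1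
        5, adjInd_le_one G σ 1 6, adjInd_le_one G σ 1 7, adjInd_le_one G σ 2 3, adjInd_le_one G σ
        2 4, adjInd_le_one G σ 2 5, adjInd_le_one G σ 2 6, adjInd_le_one G σ 2 7, adjInd_le_one G' σ 0 1, adjInd_le_one G' σ 0 2, adjInd_le_one G' σ 1 2, adjInd_le_one G' σ 0 3,
        adjInd_le_one G' σ 0 4, adjInd_le_one G' σ 1 3, adjInd_le_one G' σ 1 4, adjInd_le_one G' σ
        2 3, adjInd_le_one G' σ 2 4]

/-- Five vertices of degree at most three in a graph on eight vertices with sixteen edges: after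
possibly exchanging one edge there is an edge `{3, 4}` among the five, and the bipartite graph
between `{0, 1, 2}` and the rest is almost complete. -/
theorem IsTransversal.exists_labelling [Fintype V] (hV : Fintype.card V = 8)
    (hG : IsTransversal d G) (he : 16 ≤ G.edgeFinset.card) {Y : Finset V} (hY : Y.card = 5)
    (hdeg : ∀ y ∈ Y, G.degree y ≤ 3) :
    ∃ (G' : SimpleGraph V) (σ : Fin 8 ≃ V), IsTransversal d G' ∧ G'.Adj (σ 3) (σ 4) ∧
      (17 ≤ G.edgeFinset.card → 11 ≤ adjInd G' σ 0 4 + adjInd G' σ 0 5 + adjInd G' σ 0 6 + adjInd G' σ 0 7 + adjInd G' σ 1 4 + adjInd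
        G' σ 1 5 + adjInd G' σ 1 6 + adjInd G' σ 1 7 + adjInd G' σ 2 4 + adjInd G' σ 2 5 + adjInd
        G' σ 2 6 + adjInd G' σ 2 7) ∧
      7 ≤ adjInd G' σ 0 5 + adjInd G' σ 0 6 + adjInd G' σ 0 7 + adjInd G' σ 1 5 + adjInd G' σ 1 6 + adjInd
        G' σ 1 7 + adjInd G' σ 2 5 + adjInd G' σ 2 6 + adjInd G' σ 2 7 := by
  by_cases hy : ∃ b₁ ∈ Y, ∃ b₂ ∈ Y, G.Adj b₁ b₂
  · obtain ⟨b₁, h1, b₂, h2, h12⟩ := hy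
    obtain ⟨σ, rfl, rfl, h5, h6, h7⟩ := AntiRamsey.exists_labelling hV hY h1 h2 h12.ne
    exact ⟨G, σ, hG, h12, le_sum_adjInd_of_degree_le he h12 (hdeg _ h1) (hdeg _ h2) (hdeg _ h5)
      (hdeg _ h6) (hdeg _ h7)⟩
  · push Not at hy
    -- A vertex of degree at most 2 is preferred as an end of the new edge, since few bipartite
    -- edges are then lost by discarding it.
    obtain ⟨b₁, h1, hb₁⟩ : ∃ b₁ ∈ Y, G.degree b₁ ≤ 2 ∨ ∀ y ∈ Y, 3 ≤ G.degree y := by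
      by_cases h : ∃ b₁ ∈ Y, G.degree b₁ ≤ 2
      · obtain ⟨b₁, h1, h⟩ := h
        exact ⟨b₁, h1, Or.inl h⟩
      · push Not at h
        obtain ⟨b₁, h1⟩ : Y.Nonempty := Finset.card_pos.1 (by omega)
        exact ⟨b₁, h1, Or.inr h⟩
    obtain ⟨b₂, h2, h12⟩ := Finset.exists_mem_ne (by omega : 1 < Y.card) b₁
    obtain ⟨σ, rfl, rfl, h5, h6, h7⟩ := AntiRamsey.exists_labelling hV hY h1 h2 h12.symm
    obtain ⟨e, G', hG', hadj⟩ := hG.exists_swap h12.symm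
    have hσY : ∀ i, 3 ≤ i → σ i ∈ Y := by
      intro i hi
      fin_cases i
      exacts [absurd hi (by decide), absurd hi (by decide), absurd hi (by decide), h1, h2, h5, h6, h7]
    refine ⟨G', σ, hG', by simp [hadj],
      le_sum_adjInd_of_swap he (hG.card_edgeFinset_eq hG') hadj ?_ ?_⟩
    · intro i j hi hj
      simp [adjInd, hy _ (hσY i hi) _ (hσY j hj)]
    · exact hb₁.imp_right fun h i hi => h _ (hσY i hi)

end AntiRamsey

/-! ### Eight vertices, sixteen edges: the degree bounds 2, 2, 2, 4, 4, 4 -/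

namespace AntiRamsey

open scoped Classical

variable {V : Type*} {d : Sym2 V → ℕ} {G G' : SimpleGraph V}

theorem exists_labelling_of_subset [Fintype V] (hV : Fintype.card V = 8) {X Y : Finset V}
    (hXY : X ⊆ Y) (hX : X.card = 3) (hY : Y.card = 6) :
    ∃ σ : Fin 8 ≃ V, σ 0 ∈ X ∧ σ 1 ∈ X ∧ σ 2 ∈ X ∧ σ 3 ∈ Y ∧ σ 4 ∈ Y ∧ σ 5 ∈ Y := by
  have hA : Yᶜ.card = 2 := by rw [Finset.card_compl, hV, hY]
  have hB : (Y \ X).card = 3 := by rw [Finset.card_sdiff_of_subset hXY, hX, hY]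
  obtain ⟨x₁, x₂, x₃, hx12, hx13, hx23, rfl⟩ := Finset.card_eq_three.1 hX
  obtain ⟨a₁, a₂, ha12, hA⟩ := Finset.card_eq_two.1 hA
  obtain ⟨z₁, z₂, z₃, hz12, hz13, hz23, hB⟩ := Finset.card_eq_three.1 hB
  have hA' : ∀ a ∈ ({a₁, a₂} : Finset V), a ∉ Y := fun a ha => by
    rw [← hA] at ha; simpa using ha
  have hB' : ∀ b ∈ ({z₁, z₂, z₃} : Finset V), b ∈ Y ∧ b ≠ x₁ ∧ b ≠ x₂ ∧ b ≠ x₃ := fun b hb => by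
    rw [← hB] at hb; simpa using hb
  have hX' : ∀ x ∈ ({x₁, x₂, x₃} : Finset V), x ∈ Y := hXY
  simp only [Finset.mem_insert, Finset.mem_singleton, forall_eq_or_imp, forall_eq] at hA' hB' hX'
  obtain ⟨σ, hσ⟩ := exists_equiv_of_nodup hV (l := [x₁, x₂, x₃, z₁, z₂, z₃, a₁, a₂])
    (by simp only [List.nodup_cons, List.mem_cons, not_or]; constructorm* _ ∧ _ <;> grind) rfl x₁
  exact ⟨σ, by simp [hσ 0], by simp [hσ 1], by simp [hσ 2], (hσ 3).symm ▸ hB'.1.1,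
    (hσ 4).symm ▸ hB'.2.1.1, (hσ 5).symm ▸ hB'.2.2.1⟩

/-- The graph with sixteen edges attaining the degree bounds `2, 2, 2, 4, 4, 4, 7, 7`. -/
theorem adjInd_eq_of_degree_le [Fintype V] {σ : Fin 8 ≃ V} (he : G.edgeFinset.card = 16)
    (h0 : G.degree (σ 0) ≤ 2) (h1 : G.degree (σ 1) ≤ 2) (h2 : G.degree (σ 2) ≤ 2)
    (h3 : G.degree (σ 3) ≤ 4) (h4 : G.degree (σ 4) ≤ 4) (h5 : G.degree (σ 5) ≤ 4) :
    adjInd G σ 0 1 = 0 ∧ adjInd G σ 2 6 = 1 ∧ adjInd G σ 3 4 = 1 ∧ adjInd G σ 5 7 = 1 ∧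
      adjInd G σ 2 7 = 1 ∧ adjInd G σ 3 5 = 1 ∧ adjInd G σ 4 6 = 1 := by
  have hc := card_edgeFinset_expansion G σ
  obtain ⟨d0, d1, d2, d3, d4, d5, d6, d7⟩ := degree_expansion G σ
  have l06 := adjInd_le_one G σ 0 6
  have l07 := adjInd_le_one G σ 0 7
  have l16 := adjInd_le_one G σ 1 6
  have l17 := adjInd_le_one G σ 1 7
  have l26 := adjInd_le_one G σ 2 6
  have l27 := adjInd_le_one G σ 2 7
  have l34 := adjInd_le_one G σ 3 4
  have l35 := adjInd_le_one G σ 3 5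
  have l36 := adjInd_le_one G σ 3 6
  have l37 := adjInd_le_one G σ 3 7
  have l45 := adjInd_le_one G σ 4 5
  have l46 := adjInd_le_one G σ 4 6
  have l47 := adjInd_le_one G σ 4 7
  have l56 := adjInd_le_one G σ 5 6
  have l57 := adjInd_le_one G σ 5 7
  have l67 := adjInd_le_one G σ 6 7
  -- Only 13 pairs meet {6, 7}, so all of them are edges; this exhausts the degrees of 0, 1 and 2.
  have s6 : 13 ≤ adjInd G σ 0 6 + adjInd G σ 0 7 + adjInd G σ 1 6 + adjInd G σ 1 7 + adjInd G σ 2 6 + adjInd G σ 2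
      7 + adjInd G σ 3 6 + adjInd G σ 3 7 + adjInd G σ 4 6 + adjInd G σ 4 7 + adjInd G σ 5 6 +
      adjInd G σ 5 7 + adjInd G σ 6 7 := by
    linarith only [hc, he, d0, d1, d2, d3, d4, d5, h0, h1, h2, h3, h4, h5, l67]
  have g06 : 1 ≤ adjInd G σ 0 6 :=
    by linarith only [s6, l07, l16, l17, l26, l27, l36, l37, l46, l47, l56, l57, l67]
  have g07 : 1 ≤ adjInd G σ 0 7 :=
    by linarith only [s6, l06, l16, l17, l26, l27, l36, l37, l46, l47, l56, l57, l67]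
  have g16 : 1 ≤ adjInd G σ 1 6 :=
    by linarith only [s6, l06, l07, l17, l26, l27, l36, l37, l46, l47, l56, l57, l67]
  have g17 : 1 ≤ adjInd G σ 1 7 :=
    by linarith only [s6, l06, l07, l16, l26, l27, l36, l37, l46, l47, l56, l57, l67]
  have g26 : 1 ≤ adjInd G σ 2 6 :=
    by linarith only [s6, l06, l07, l16, l17, l27, l36, l37, l46, l47, l56, l57, l67]
  have g27 : 1 ≤ adjInd G σ 2 7 :=
    by linarith only [s6, l06, l07, l16, l17, l26, l36, l37, l46, l47, l56, l57, l67]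
  have g46 : 1 ≤ adjInd G σ 4 6 :=
    by linarith only [s6, l06, l07, l16, l17, l26, l27, l36, l37, l47, l56, l57, l67]
  have g57 : 1 ≤ adjInd G σ 5 7 :=
    by linarith only [s6, l06, l07, l16, l17, l26, l27, l36, l37, l46, l47, l56, l67]
  have g01 : adjInd G σ 0 1 = 0 := by linarith only [d0, h0, g06, g07]
  have g03 : adjInd G σ 0 3 = 0 := by linarith only [d0, h0, g06, g07]
  have g13 : adjInd G σ 1 3 = 0 := by linarith only [d1, h1, g16, g17]
  have g23 : adjInd G σ 2 3 = 0 := by linarith only [d2, h2, g26, g27]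
  -- The degree sum 32 equals the sum of all the upper bounds, so each is attained.
  have s3 : 4 ≤ G.degree (σ 3) := by
    linarith only [hc, he, d0, d1, d2, d3, d4, d5, d6, d7, h0, h1, h2, h4, h5, l06, l07, l16, l17, l26, l27, l36, l37, l46, l47, l56, l57, l67]
  have g34 : 1 ≤ adjInd G σ 3 4 := by linarith only [d3, s3, g03, g13, g23, l35, l36, l37]
  have g35 : 1 ≤ adjInd G σ 3 5 := by linarith only [d3, s3, g03, g13, g23, l34, l36, l37]
  exact ⟨g01, le_antisymm l26 g26, le_antisymm l34 g34, le_antisymm l57 g57, le_antisymm l27 g27,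
    le_antisymm l35 g35, le_antisymm l46 g46⟩

/-- In the forced graph 0, 1, 2 see only 6 and 7, so there is no perfect matching. After the edge 01
is exchanged in, the matchings {26, 34, 57} and {27, 35, 46} each complete it; they are disjoint, so
the one lost edge spoils at most one of them. -/
theorem IsTransversal.exists_isContained_of_card_eq_sixteen [Fintype V]
    (hV : Fintype.card V = 8) (hG : IsTransversal d G) (he : G.edgeFinset.card = 16)
    {X Y : Finset V} (hXY : X ⊆ Y) (hX : X.card = 3) (hY : Y.card = 6)
    (hdX : ∀ x ∈ X, G.degree x ≤ 2) (hdY : ∀ y ∈ Y, G.degree y ≤ 4) :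
    ∃ G', IsTransversal d G' ∧ (copies 4 (SimpleGraph.pathGraph 2)).IsContained G' := by
  obtain ⟨σ, h0, h1, h2, h3, h4, h5⟩ := exists_labelling_of_subset hV hXY hX hY
  obtain ⟨g01, g26, g34, g57, g27, g35, g46⟩ := adjInd_eq_of_degree_le he (hdX _ h0) (hdX _ h1)
    (hdX _ h2) (hdY _ h3) (hdY _ h4) (hdY _ h5)
  obtain ⟨e, G', hG', hadj⟩ := hG.exists_swap (σ.injective.ne (show (0 : Fin 8) ≠ 1 by decide))
  have H : ∀ i j, s(i, j) ≠ s(0, 1) → adjInd G' σ i j ≤ adjInd G σ i j := by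
    intro i j hij
    refine adjInd_le_of_imp fun h => ?_
    rcases (hadj _ _).1 h with h | h
    · rw [Sym2.eq_iff] at h
      simp only [σ.injective.eq_iff] at h
      exact absurd (Sym2.eq_iff.2 h) hij
    · exact h.1
  have hA01 : G'.Adj (σ 0) (σ 1) := by simp [hadj]
  have h01 : adjInd G' σ 0 1 = 1 := by simp [adjInd, hA01]
  have hc := card_edgeFinset_expansion G σ
  have hc' := card_edgeFinset_expansion G' σ
  rw [← hG.card_edgeFinset_eq hG'] at hc'
  have hsum : 5 ≤ adjInd G' σ 2 6 + adjInd G' σ 3 4 + adjInd G' σ 5 7 + adjInd G' σ 2 7 + adjInd G' σ 3 5 + adjInd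
      G' σ 4 6 := by
    linarith [H 0 2 (by decide), H 0 3 (by decide), H 0 4 (by decide), H 0 5 (by decide), H 0 6 (by decide), H 0
      7 (by decide), H 1 2 (by decide), H 1 3 (by decide), H 1 4 (by decide), H 1 5 (by decide), H
      1 6 (by decide), H 1 7 (by decide), H 2 3 (by decide), H 2 4 (by decide), H 2 5 (by decide),
      H 3 6 (by decide), H 3 7 (by decide), H 4 5 (by decide), H 4 7 (by decide), H 5 6 (by
      decide), H 6 7 (by decide)]
  have l26 := adjInd_le_one G' σ 2 6
  have l34 := adjInd_le_one G' σ 3 4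
  have l57 := adjInd_le_one G' σ 5 7
  have l27 := adjInd_le_one G' σ 2 7
  have l35 := adjInd_le_one G' σ 3 5
  have l46 := adjInd_le_one G' σ 4 6
  refine ⟨G', hG', ?_⟩
  rcases (by omega : (0 < adjInd G' σ 2 6 ∧ 0 < adjInd G' σ 3 4 ∧ 0 < adjInd G' σ 5 7) ∨
      (0 < adjInd G' σ 2 7 ∧ 0 < adjInd G' σ 3 5 ∧ 0 < adjInd G' σ 4 6)) with h | h
  · refine isContained_four_copies_pathGraph_two (σ := σ) (l := [0, 1, 2, 6, 3, 4, 5, 7])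
      (by decide) rfl fun i hi => ?_
    interval_cases i
    exacts [hA01, adj_of_adjInd h.1, adj_of_adjInd h.2.1, adj_of_adjInd h.2.2]
  · refine isContained_four_copies_pathGraph_two (σ := σ) (l := [0, 1, 2, 7, 3, 5, 4, 6])
      (by decide) rfl fun i hi => ?_
    interval_cases i
    exacts [hA01, adj_of_adjInd h.1, adj_of_adjInd h.2.1, adj_of_adjInd h.2.2]

/-! ### The upper bounds on the number of colours -/

section

variable [Fintype V]

theorem exists_isTransversal_copies_pathGraph_four {k : ℕ} (hk : 2 ≤ k)
    (hV : Fintype.card V = 4 * k) (hG : IsTransversal d G)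
    (he : (Fintype.card V - 2).choose 2 + 2 ≤ G.edgeFinset.card) :
    ∃ G', IsTransversal d G' ∧ (copies k (SimpleGraph.pathGraph 4)).IsContained G' := by
  obtain ⟨G₁, hG₁, ht | ⟨h8, Y, hY, hdeg⟩⟩ := exists_isTransversal_traceable_or (by omega) hG he
  · exact ⟨G₁, hG₁, ht.isContained_copies (by omega)⟩
  · rw [hG.card_edgeFinset_eq hG₁, h8, show Nat.choose (8 - 2) 2 = 15 by decide] at he
    obtain ⟨G₂, σ, hG₂, h34, hsum, -⟩ := hG₁.exists_labelling h8 (by omega) hY hdeg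
    obtain rfl : k = 2 := by omega
    exact ⟨G₂, hG₂, isContained_two_copies_pathGraph_four_of_adjInd h34 (hsum he)⟩

theorem exists_isTransversal_copies_pathGraph_two {k : ℕ} (hk : 2 ≤ k)
    (hV : Fintype.card V = 4 * k) (hG : IsTransversal d G)
    (he : (Fintype.card V - 2).choose 2 + 1 ≤ G.edgeFinset.card) :
    ∃ G', IsTransversal d G' ∧ (copies (2 * k) (SimpleGraph.pathGraph 2)).IsContained G' := by
  obtain ⟨G₁, hG₁, h | ⟨h8, Y, hY, hdeg⟩ | ⟨h8, h16, X, Y, hXY, hX, hY, hdX, hdY⟩⟩ :=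
    exists_isTransversal_matching_or (m := 2 * k) (by omega) (by omega) hG he
  · exact ⟨G₁, hG₁, h⟩
  · rw [hG.card_edgeFinset_eq hG₁, h8, show Nat.choose (8 - 2) 2 = 15 by decide] at he
    obtain ⟨G₂, σ, hG₂, h34, -, hsum⟩ := hG₁.exists_labelling h8 he hY hdeg
    obtain rfl : k = 2 := by omega
    exact ⟨G₂, hG₂, isContained_four_copies_pathGraph_two_of_adjInd h34 hsum⟩
  · obtain rfl : k = 2 := by omega
    exact hG₁.exists_isContained_of_card_eq_sixteen h8 h16 hXY hX hY hdX hdY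

/-- A colouring without a rainbow copy of `H` uses at most `N` colours as soon as every transversal
with more than `N` edges can be exchanged for one containing `H`. -/
theorem ncard_range_le_of_not_hasRainbowCopy {W : Type*} {H : SimpleGraph W} {N : ℕ}
    (h : ∀ (d : Sym2 V → ℕ) (G : SimpleGraph V), IsTransversal d G → N + 1 ≤ G.edgeFinset.card →
      ∃ G', IsTransversal d G' ∧ H.IsContained G')
    {c : (⊤ : SimpleGraph V).edgeSet → ℕ} (hc : ¬ HasRainbowCopy c H) :
    (Set.range c).ncard ≤ N := by
  let d : Sym2 V → ℕ := fun e => if he : e ∈ (⊤ : SimpleGraph V).edgeSet then c ⟨e, he⟩ else 0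
  have hd : ∀ e : (⊤ : SimpleGraph V).edgeSet, d e.1 = c e := fun e => dif_pos e.2
  have hrange : d '' (⊤ : SimpleGraph V).edgeSet = Set.range c := by
    ext x
    constructor
    · rintro ⟨e, he, rfl⟩
      exact ⟨⟨e, he⟩, (hd ⟨e, he⟩).symm⟩
    · rintro ⟨e, rfl⟩
      exact ⟨e.1, e.2, hd e⟩
  obtain ⟨G, hG⟩ := exists_isTransversal d
  by_contra! hlt
  obtain ⟨G', hG', hH⟩ := h d G hG (by rw [hG.card_edgeFinset, hrange]; exact hlt)
  exact hc (hasRainbowCopy_of_isTransversal hd hG' hH)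

end

end AntiRamsey

/-! ### The extremal colouring and the conclusion -/

namespace AntiRamsey

open scoped Classical

/-- The colouring giving colour `0` to all edges meeting `{u, v}` and pairwise distinct colours to
all other edges. -/
noncomputable def pairColouring {V : Type*} [Finite V] (u v : V)
    (e : (⊤ : SimpleGraph V).edgeSet) : ℕ :=
  if u ∈ e.1 ∨ v ∈ e.1 then 0 else (Finite.equivFin (Sym2 V) e.1).1 + 1

theorem ncard_range_pairColouring {V : Type*} [Fintype V] {u v : V} (huv : u ≠ v) :
    (Set.range (pairColouring u v)).ncard = (Fintype.card V - 2).choose 2 + 1 := by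
  let s : Finset V := {u, v}ᶜ
  -- The shift by one keeps the private colours away from the common colour `0`.
  let enc : Sym2 V → ℕ := fun e => (Finite.equivFin (Sym2 V) e).1 + 1
  have henc : Function.Injective enc := fun a b hab =>
    (Finite.equivFin (Sym2 V)).injective (Fin.ext (Nat.succ_injective hab))
  have hrange : Set.range (pairColouring u v) =
      insert 0 (enc '' (s.offDiag.image Sym2.mk.uncurry : Finset (Sym2 V))) := by
    ext x
    constructor
    · rintro ⟨⟨e, he⟩, rfl⟩
      by_cases h : u ∈ e ∨ v ∈ e
      · exact Or.inl (if_pos h)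
      · refine Or.inr ⟨e, ?_, (if_neg h).symm⟩
        induction e with | _ a b
        refine Finset.mem_coe.2 (Finset.mem_image.2 ⟨(a, b), ?_, rfl⟩)
        simp [s] at he h ⊢
        tauto
    · rintro (rfl | ⟨e, he, rfl⟩)
      · exact ⟨⟨s(u, v), by simpa using huv⟩, if_pos (by simp)⟩
      · obtain ⟨⟨a, b⟩, hab, rfl⟩ := Finset.mem_image.1 (Finset.mem_coe.1 he)
        simp [s] at hab
        refine ⟨⟨s(a, b), by simpa using hab.2.2⟩, if_neg ?_⟩
        simp
        tauto
  rw [hrange, Set.ncard_insert_of_notMem, Set.ncard_image_of_injective _ henc,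
    Set.ncard_coe_finset, Sym2.card_image_offDiag, Finset.card_compl, Finset.card_pair huv]
  rintro ⟨e, -, he⟩
  exact Nat.succ_ne_zero _ he

/-- This is false for `pathGraph 2`, where the two ends of an edge have only that edge. -/
theorem exists_adj_ne_copies_pathGraph_four {k : ℕ} {x y : Fin k × Fin 4} (hxy : x ≠ y) :
    ∃ x' y', (copies k (SimpleGraph.pathGraph 4)).Adj x x' ∧
      (copies k (SimpleGraph.pathGraph 4)).Adj y y' ∧ s(x, x') ≠ s(y, y') := by
  obtain ⟨i, a⟩ := x
  obtain ⟨j, b⟩ := y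
  have hnbr : ∀ a : Fin 4, ∃ a', (SimpleGraph.pathGraph 4).Adj a a' := by
    simp only [SimpleGraph.pathGraph_adj]
    decide
  by_cases hij : i = j
  · subst hij
    have hab : ∀ a b : Fin 4, a ≠ b → ∃ a' b', (SimpleGraph.pathGraph 4).Adj a a' ∧
        (SimpleGraph.pathGraph 4).Adj b b' ∧ ¬ (a = b' ∧ a' = b) := by
      simp only [SimpleGraph.pathGraph_adj]
      decide
    obtain ⟨a', b', ha, hb, hne⟩ := hab a b fun h => hxy (by rw [h])
    refine ⟨(i, a'), (i, b'), ⟨rfl, ha⟩, ⟨rfl, hb⟩, fun h => ?_⟩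
    rcases Sym2.eq_iff.1 h with h | h
    · exact hxy h.1
    · exact hne ⟨congrArg Prod.snd h.1, congrArg Prod.snd h.2⟩
  · obtain ⟨a', ha⟩ := hnbr a
    obtain ⟨b', hb⟩ := hnbr b
    refine ⟨(i, a'), (j, b'), ⟨rfl, ha⟩, ⟨rfl, hb⟩, fun h => ?_⟩
    rcases Sym2.eq_iff.1 h with h | h
    · exact hxy h.1
    · exact hij (congrArg Prod.fst h.1)

theorem not_hasRainbowCopy_pairColouring {V : Type*} [Fintype V] {k : ℕ}
    (hV : Fintype.card V = 4 * k) {u v : V} (huv : u ≠ v) :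
    ¬ HasRainbowCopy (pairColouring u v) (copies k (SimpleGraph.pathGraph 4)) := by
  rintro ⟨f, hf⟩
  -- The copy is spanning, so it cannot avoid `u` or `v`.
  have hbij : Function.Bijective f := (Fintype.bijective_iff_injective_and_card _).2
    ⟨f.injective, by simp [hV, mul_comm]⟩
  obtain ⟨x, rfl⟩ := hbij.surjective u
  obtain ⟨y, rfl⟩ := hbij.surjective v
  obtain ⟨x', y', hx, hy, hne⟩ := exists_adj_ne_copies_pathGraph_four
    (fun h => huv (congrArg f h) : x ≠ y)
  have h1 : pairColouring (f x) (f y) (f.mapEdgeSet ⟨s(x, x'), hx⟩) = 0 :=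
    if_pos (Or.inl (Sym2.mem_mk_left (f x) (f x')))
  have h2 : pairColouring (f x) (f y) (f.mapEdgeSet ⟨s(y, y'), hy⟩) = 0 :=
    if_pos (Or.inr (Sym2.mem_mk_left (f y) (f y')))
  exact hne (congrArg Subtype.val (hf (h1.trans h2.symm)))

theorem antiRamsey_copies_pathGraph_four {k : ℕ} (hk : 2 ≤ k) :
    antiRamsey (4 * k) (copies k (SimpleGraph.pathGraph 4)) = (4 * k - 2).choose 2 + 1 := by
  have hV : Fintype.card (Fin (4 * k)) = 4 * k := Fintype.card_fin _
  refine IsGreatest.csSup_eq ⟨?_, ?_⟩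
  · have huv : (⟨0, by omega⟩ : Fin (4 * k)) ≠ ⟨1, by omega⟩ := by simp
    refine ⟨pairColouring _ _, not_hasRainbowCopy_pairColouring hV huv, ?_⟩
    rw [ncard_range_pairColouring huv, hV]
  · rintro m ⟨c, hc, rfl⟩
    refine ncard_range_le_of_not_hasRainbowCopy (fun d G hG he => ?_) hc
    exact exists_isTransversal_copies_pathGraph_four hk hV hG (by rw [hV]; exact he)

theorem antiRamsey_copies_pathGraph_two_le {k : ℕ} (hk : 2 ≤ k) :
    antiRamsey (4 * k) (copies (2 * k) (SimpleGraph.pathGraph 2)) ≤ (4 * k - 2).choose 2 := by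
  have hV : Fintype.card (Fin (4 * k)) = 4 * k := Fintype.card_fin _
  -- Only an upper bound is needed here, so no colouring without a rainbow matching has to be
  -- exhibited.
  refine csSup_le' ?_
  rintro m ⟨c, hc, rfl⟩
  refine ncard_range_le_of_not_hasRainbowCopy (fun d G hG he => ?_) hc
  exact exists_isTransversal_copies_pathGraph_two hk hV hG (by rw [hV]; exact he)

end AntiRamsey

theorem theorem4 (k n : ℕ) (hk : 2 ≤ k) (hn : n = 4 * k) :
    AntiRamsey.antiRamsey n (AntiRamsey.copies k (SimpleGraph.pathGraph 4)) =
        (2 * k - 1) * (4 * k - 3) + 1 ∧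
      AntiRamsey.antiRamsey n (AntiRamsey.copies (2 * k) (SimpleGraph.pathGraph 2)) <
        AntiRamsey.antiRamsey n (AntiRamsey.copies k (SimpleGraph.pathGraph 4)) := by
  subst hn
  have h1 := AntiRamsey.antiRamsey_copies_pathGraph_four hk
  have h2 := AntiRamsey.antiRamsey_copies_pathGraph_two_le hk
  have h3 : (4 * k - 2).choose 2 = (2 * k - 1) * (4 * k - 3) := by
    have h := AntiRamsey.choose_two_mul_two (4 * k - 2)
    rw [show 4 * k - 2 - 1 = 4 * k - 3 by omega, show 4 * k - 2 = 2 * (2 * k - 1) by omega,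
      mul_assoc] at h
    rw [show 4 * k - 2 = 2 * (2 * k - 1) by omega]
    exact Nat.eq_of_mul_eq_mul_left two_pos h
  exact ⟨by rw [h1, h3], by omega⟩
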